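/- **Setting.** An *environment* consists of a finite set of line segments in the plane, a start point $p_0\in\mathbb Z^2$ and an initial direction $d_0=(x,y)\in\mathbb Z^2\setminus\{0\}$. Each segment is nondegenerate, has integer endpoints, is horizontal, vertical or at a $45^\circ$ angle to the axes, and each of its two sides is marked reflective or non-reflective. A *ray* is a triple (starting point, direction, orientation) with orientation in $\{+,-\}$; the initial ray is $(p_0,d_0,+)$. After leaving its starting point, a ray travels straight until it first reaches a point of a segment not parallel to it, an endpoint of any segment, or the point $p_0$ while travelling in direction $d_0$. If it reaches no such point, it *escapes to infinity*. There it is *absorbed* if the point is an endpoint of a segment or lies on two different segments, if it strikes a non-reflective side, or if it is back at its initial position and direction (it arrives at $p_0$ in direction $d_0$, or would be reflected at $p_0$ into direction $d_0$). Otherwise it is *reflected*: the reflected ray emanates from the point that was hit, in the mirror-image direction, with the opposite orientation. A *partial integer interval exchange transformation* $f$ on the range $[0,M-1]$ is a system of disjoint integer subintervals of this range, each of which is translated by $f$ to a subinterval of the range, such that the target subintervals are also disjoint. Its domain is the union of the given subintervals. **Statement.** There is an algorithm that, given any environment, constructs in time polynomial in the number of bits of the input a partial integer interval exchange transformation $f$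 on a range $[0,M-1]$, together with a description of a one-to-one map $v\mapsto r_v$ from $[0,M-1]$ to rays and the value $v_0$ with $r_{v_0}=(p_0,d_0,+)$. The map is described by a partition of the range into consecutive blocks, on each of which the direction and the orientation are fixed and the starting points are evenly spaced along a line. Each $r_v$ is the initial ray, or has a direction among $(\pm x,\pm y),(\pm y,\pm x)$ and emanates from an interior point of a segment on a reflective side. Moreover, for every $v\in[0,M-1]$: - if $v$ belongs to the domain of $f$, then the ray $r_v$ is reflected by the environment, and $r_{f(v)}$ is the ray emanating from its first reflection; - if $v$ does not belong to the domain of $f$, then the ray $r_v$ is absorbed before being reflected, or escapes to infinity. -/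

import Mathlib

namespace MirrorMaze

/-! ### A programming language with a bit-cost (logarithmic-cost) running time -/

/-- The values that programs manipulate: integers and pairs. -/
inductive Data where
  | int (z : ℤ)
  | pair (a b : Data)

/-- The size of a value: the number of bits of its integers, plus one per node. -/
def Data.size : Data → ℕ
  | .int z => 1 + Nat.size z.natAbs
  | .pair a b => 1 + a.size + b.size

/-- The primitive operations. -/
inductive Prim where
  | id | const (z : ℤ) | fst | snd | isPair | add | sub | mul | div | mod | lt

/-- The effect of a primitive operation. The arithmetic operations and the comparison act on a pair
of integers. Everything ill-typed gives the integer `0`. -/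
def Prim.apply : Prim → Data → Data
  | .id, x => x
  | .const z, _ => .int z
  | .fst, .pair a _ => a
  | .snd, .pair _ b => b
  | .isPair, .pair _ _ => .int 1
  | .add, .pair (.int a) (.int b) => .int (a + b)
  | .sub, .pair (.int a) (.int b) => .int (a - b)
  | .mul, .pair (.int a) (.int b) => .int (a * b)
  | .div, .pair (.int a) (.int b) => .int (a / b)
  | .mod, .pair (.int a) (.int b) => .int (a % b)
  | .lt, .pair (.int a) (.int b) => .int (if a < b then 1 else 0)
  | _, _ => .int 0

/-- Programs. Each one transforms an input value into an output value. -/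
inductive Prog where
  /-- a primitive operation -/
  | prim (o : Prim)
  /-- the pair of the outputs of two programs on the same input -/
  | pair (p q : Prog)
  /-- first `p`, then `q` on the output of `p` -/
  | seq (p q : Prog)
  /-- run `p` if `c` outputs something other than the integer `0`, and `q` otherwise -/
  | ite (c p q : Prog)
  /-- replace the current value `x` by `p x` as long as `c` on `x` outputs something other than the
  integer `0` -/
  | loop (c p : Prog)

/-- `Runs p x y t`: on input `x` the program `p` halts with output `y` after time `t`. Every single
step is charged the total size of the values that it reads and writes. -/
inductive Runs : Prog → Data → Data → ℕ → Prop
  | prim (o : Prim) (x : Data) :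
      Runs (.prim o) x (o.apply x) (1 + x.size + (o.apply x).size)
  | pair {p q : Prog} {x y z : Data} {s t : ℕ} :
      Runs p x y s → Runs q x z t →
      Runs (.pair p q) x (.pair y z) (s + t + (1 + x.size + (Data.pair y z).size))
  | seq {p q : Prog} {x y z : Data} {s t : ℕ} :
      Runs p x y s → Runs q y z t → Runs (.seq p q) x z (s + t + 1)
  | ite_true {c p q : Prog} {x b y : Data} {s t : ℕ} :
      Runs c x b s → b ≠ .int 0 → Runs p x y t →
      Runs (.ite c p q) x y (s + t + (1 + x.size))
  | ite_false {c p q : Prog} {x y : Data} {s t : ℕ} :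
      Runs c x (.int 0) s → Runs q x y t →
      Runs (.ite c p q) x y (s + t + (1 + x.size))
  | loop_done {c p : Prog} {x : Data} {s : ℕ} :
      Runs c x (.int 0) s → Runs (.loop c p) x x (s + (1 + x.size))
  | loop_step {c p : Prog} {x b y z : Data} {s t u : ℕ} :
      Runs c x b s → b ≠ .int 0 → Runs p x y t → Runs (.loop c p) y z u →
      Runs (.loop c p) x z (s + t + u + (1 + x.size))

/-! ### Encoding of inputs and outputs as values -/

def encBool (b : Bool) : Data := .int (if b then 1 else 0)

def encNat (n : ℕ) : Data := .int n

def encVec (v : ℤ × ℤ) : Data := .pair (.int v.1) (.int v.2)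

/-- Lists are nested pairs, ending in the integer `0`. -/
def encList {α : Type} (enc : α → Data) : List α → Data
  | [] => .int 0
  | a :: l => .pair (enc a) (encList enc l)

/-! ### Environments -/

/-- The dot product. -/
def dot (u v : ℤ × ℤ) : ℤ := u.1 * v.1 + u.2 * v.2

/-- The cross product: positive if `v` points to the left of `u`, zero if they are parallel. -/
def cross (u v : ℤ × ℤ) : ℤ := u.1 * v.2 - u.2 * v.1

/-- Integer vectors as points or vectors of the real plane. -/
def toPlane (v : ℤ × ℤ) : ℝ × ℝ := ((v.1 : ℝ), (v.2 : ℝ))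

/-- A line segment with integer endpoints. Its two sides, left and right as seen when going from `a`
to `b`, are marked as reflective (`true`) or non-reflective (`false`). -/
structure MirrorSegment where
  a : ℤ × ℤ
  b : ℤ × ℤ
  left : Bool
  right : Bool

namespace MirrorSegment

/-- The vector from one endpoint to the other. -/
def vec (s : MirrorSegment) : ℤ × ℤ := s.b - s.a

/-- The points of the segment, endpoints included. -/
def points (s : MirrorSegment) : Set (ℝ × ℝ) := segment ℝ (toPlane s.a) (toPlane s.b)

/-- The segment is nondegenerate, and horizontal, vertical or at `45` degrees to the axes. -/
def Octilinear (s : MirrorSegment) : Prop :=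
  s.a ≠ s.b ∧ (s.vec.1 = 0 ∨ s.vec.2 = 0 ∨ s.vec.1 = s.vec.2 ∨ s.vec.1 = -s.vec.2)

/-- Something that moves in direction `d` and hits the segment strikes a reflective side. -/
def ReflectsFrom (s : MirrorSegment) (d : ℤ × ℤ) : Prop :=
  (0 < cross s.vec d ∧ s.right = true) ∨ (cross s.vec d < 0 ∧ s.left = true)

/-- `d'` is the mirror image of `d`: the component along the segment is kept, and the component
across the segment is reversed. -/
def MirrorImage (s : MirrorSegment) (d d' : ℤ × ℤ) : Prop :=
  dot s.vec d' = dot s.vec d ∧ cross s.vec d' = -cross s.vec d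

def encode (s : MirrorSegment) : Data :=
  .pair (.pair (encVec s.a) (encVec s.b)) (.pair (encBool s.left) (encBool s.right))

end MirrorSegment

/-- A collection of segments (a finite set, given as a list), with the start and the initial direction of a light ray. -/
structure Environment where
  segments : List MirrorSegment
  start : ℤ × ℤ
  dir : ℤ × ℤ

/-- A ray emanating from a point, with its left-right orientation: `true` if a thickened copy of the
ray has the same orientation as at the start, `false` if it is flipped. -/
structure Ray where
  pos : ℝ × ℝ
  dir : ℤ × ℤ
  orient : Bool

/-- The point of the ray at time `t`. -/
def Ray.point (r : Ray) (t : ℝ) : ℝ × ℝ := r.pos + t • toPlane r.dir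

namespace Environment

variable (E : Environment)

/-- The inputs under consideration: octilinear segments and a nonzero initial direction. -/
def Valid : Prop := (∀ s ∈ E.segments, s.Octilinear) ∧ E.dir ≠ 0

def encode : Data :=
  .pair (encList MirrorSegment.encode E.segments) (.pair (encVec E.start) (encVec E.dir))

/-- The initial ray. -/
def startRay : Ray := ⟨toPlane E.start, E.dir, true⟩

/-- `q` is an endpoint of one of the segments. -/
def IsEndpoint (q : ℝ × ℝ) : Prop :=
  ∃ s ∈ E.segments, q = toPlane s.a ∨ q = toPlane s.b

/-- `q` lies on two different segments. -/
def IsCommon (q : ℝ × ℝ) : Prop :=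
  ∃ s ∈ E.segments, ∃ s' ∈ E.segments, s ≠ s' ∧ q ∈ s.points ∧ q ∈ s'.points

/-- At time `t` the ray meets something: a segment that is not parallel to the ray, an endpoint of
any segment, or the start, traversed in the initial direction. -/
def Meets (r : Ray) (t : ℝ) : Prop :=
  (∃ s ∈ E.segments, cross s.vec r.dir ≠ 0 ∧ r.point t ∈ s.points) ∨
  E.IsEndpoint (r.point t) ∨
  (r.point t = toPlane E.start ∧ r.dir = E.dir)

/-- After leaving its own origin, the ray meets something at time `t` for the first time. -/
def FirstMeets (r : Ray) (t : ℝ) : Prop :=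
  0 < t ∧ E.Meets r t ∧ ∀ t', 0 < t' → t' < t → ¬ E.Meets r t'

/-- What the ray meets at time `t` makes it stop: an endpoint of a segment or a common point of two
segments, a non-reflective side of a segment, or the initial position and direction, be it that the
ray arrives in this direction or that it would be reflected into it. -/
def StopsAt (r : Ray) (t : ℝ) : Prop :=
  E.IsEndpoint (r.point t) ∨
  E.IsCommon (r.point t) ∨
  (∃ s ∈ E.segments, r.point t ∈ s.points ∧ ¬ s.ReflectsFrom r.dir) ∨
  (r.point t = toPlane E.start ∧
    (r.dir = E.dir ∨ ∃ s ∈ E.segments, r.point t ∈ s.points ∧ s.MirrorImage r.dir E.dir))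

/-- The ray is reflected by the environment, and `r'` is the ray emanating from its first
reflection. Each reflection reverses the left-right orientation. -/
def ReflectsTo (r r' : Ray) : Prop :=
  ∃ t, E.FirstMeets r t ∧ ¬ E.StopsAt r t ∧
    r'.pos = r.point t ∧ r'.orient = !r.orient ∧
    ∃ s ∈ E.segments, r.point t ∈ s.points ∧ s.MirrorImage r.dir r'.dir

/-- The ray is stopped before being reflected. -/
def Absorbed (r : Ray) : Prop := ∃ t, E.FirstMeets r t ∧ E.StopsAt r t

/-- The ray goes to infinity without meeting anything. -/
def Escapes (r : Ray) : Prop := ∀ t, 0 < t → ¬ E.Meets r t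

/-- The eight directions `(±x, ±y)` and `(±y, ±x)`, where `(x, y)` is the initial direction. -/
def directions : List (ℤ × ℤ) :=
  let x := E.dir.1
  let y := E.dir.2
  [(x, y), (x, -y), (-x, y), (-x, -y), (y, x), (y, -x), (-y, x), (-y, -x)]

/-- The ray has one of the eight directions, and it emanates from an inner point of a segment, on a
reflective side. -/
def IsReflectedRay (r : Ray) : Prop :=
  r.dir ∈ E.directions ∧
  ∃ s ∈ E.segments, r.pos ∈ openSegment ℝ (toPlane s.a) (toPlane s.b) ∧
    ((0 < cross s.vec r.dir ∧ s.left = true) ∨ (cross s.vec r.dir < 0 ∧ s.right = true))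

end Environment

/-! ### Partial integer interval exchange transformations -/

/-- The subinterval `[src, src + len)` is translated to `[dst, dst + len)`. -/
structure Piece where
  src : ℕ
  len : ℕ
  dst : ℕ

def Piece.encode (p : Piece) : Data := .pair (encNat p.src) (.pair (encNat p.len) (encNat p.dst))

/-- A partial integer interval exchange transformation on the range `[0, M)`: disjoint subintervals
of the range that are translated to disjoint subintervals of the range. -/
structure PartialIET where
  M : ℕ
  pieces : List Piece
  src_le : ∀ p ∈ pieces, p.src + p.len ≤ M
  dst_le : ∀ p ∈ pieces, p.dst + p.len ≤ M
  src_disjoint : pieces.Pairwise fun p q =>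
    Disjoint (Set.Ico p.src (p.src + p.len)) (Set.Ico q.src (q.src + q.len))
  dst_disjoint : pieces.Pairwise fun p q =>
    Disjoint (Set.Ico p.dst (p.dst + p.len)) (Set.Ico q.dst (q.dst + q.len))

namespace PartialIET

/-- The transformation maps `v` to `w`. -/
def Maps (f : PartialIET) (v w : ℕ) : Prop :=
  ∃ p ∈ f.pieces, v ∈ Set.Ico p.src (p.src + p.len) ∧ w = p.dst + (v - p.src)

/-- The domain: the union of the given subintervals. -/
def domain (f : PartialIET) : Set ℕ := {v | ∃ w, f.Maps v w}

def encode (f : PartialIET) : Data := .pair (encNat f.M) (encList Piece.encode f.pieces)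

end PartialIET

/-! ### The correspondence between values and rays -/

/-- A block of `len` consecutive values. They stand for parallel rays of the same orientation that
emanate from the evenly spaced points `(base + i • step) / den`, `0 ≤ i < len`. -/
structure Block where
  len : ℕ
  base : ℤ × ℤ
  step : ℤ × ℤ
  den : ℕ
  dir : ℤ × ℤ
  orient : Bool

namespace Block

/-- The ray with number `i` in the block. -/
noncomputable def rayAt (B : Block) (i : ℕ) : Ray where
  pos := ((B.den : ℝ)⁻¹) • (toPlane B.base + (i : ℝ) • toPlane B.step)
  dir := B.dir
  orient := B.orient

def encode (B : Block) : Data :=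
  .pair (encNat B.len) (.pair (encVec B.base) (.pair (encVec B.step)
    (.pair (encNat B.den) (.pair (encVec B.dir) (encBool B.orient)))))

end Block

/-- The ray described by the value `v`, where the given blocks make up the range one after the
other; `none` if `v` lies beyond the range. -/
noncomputable def rayOf : List Block → ℕ → Option Ray
  | [], _ => none
  | B :: l, v => if v < B.len then some (B.rayAt v) else rayOf l (v - B.len)

/-- The result of the construction: a transformation, the meaning of its values, and the value of
the initial ray. -/
structure Output where
  f : PartialIET
  blocks : List Block
  start : ℕ

namespace Output

def encode (O : Output) : Data :=
  .pair O.f.encode (.pair (encList Block.encode O.blocks) (encNat O.start))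

/-- `O.Describes v r`: the value `v` describes the ray `r`. -/
def Describes (O : Output) (v : ℕ) (r : Ray) : Prop := rayOf O.blocks v = some r

/-- The output is an interval exchange that is equivalent to the environment. -/
structure Correct (O : Output) (E : Environment) : Prop where
  den_pos : ∀ B ∈ O.blocks, 0 < B.den
  /-- The values, those of the range of the transformation, describe distinct rays. -/
  range : ∀ v, v < O.f.M ↔ ∃ r, O.Describes v r
  injective : ∀ v w r, O.Describes v r → O.Describes w r → v = w
  /-- They describe the initial ray and reflected rays along the segments. -/
  start : O.Describes O.start E.startRay
  values : ∀ v r, O.Describes v r → r = E.startRay ∨ E.IsReflectedRay r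
  /-- A value in the domain describes a ray that is reflected, first into that of its image. -/
  mem_domain : ∀ v ∈ O.f.domain, ∃ w r r',
    O.f.Maps v w ∧ O.Describes v r ∧ O.Describes w r' ∧ E.ReflectsTo r r'
  /-- A value outside the domain describes a ray that is absorbed before being reflected, or that
  escapes to infinity. -/
  not_mem_domain : ∀ v, v < O.f.M → v ∉ O.f.domain → ∃ r,
    O.Describes v r ∧ (E.Absorbed r ∨ E.Escapes r)

end Output

end MirrorMaze

namespace MirrorMaze

/-! ### Sizes -/

/-! A line in direction `d` is the set of points `q` with `cross d q = c`. The initial ray has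
integer position `c`. When a ray is reflected at a segment through `a`, the new direction `d'` is
the old one with coordinates swapped or negated (this is where octilinearity enters). Along the
segment `cross d q + cross d' q` is constant, so the new position is `cross d' a + cross d a - c`,
again an integer. Hence it suffices to number the rays given by a segment, one of eight directions,
an orientation and an integer position.

Everything that decides the fate of such a ray (which segment it hits first, whether the hit point
is an endpoint or a common point, whether the start is passed) is a sign condition on finitely many
integer affine functions of `c`. Rounding their zeros gives polynomially many breaks, and between
consecutive breaks, on a cell, all signs are constant (`sign_eq_of_rootBreaks`, `starts_congr`,
`hits_congr`). A segment, direction, orientation and cell on which rays may start form a beam. There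
are polynomially many beams, although the number of rays may be exponential; the initial ray is a
beam of its own.

Reflection sends `c` to a constant minus `c`, which reverses the order of positions, but it also
flips the orientation. Numbering beams by increasing position for one orientation and by decreasing
position for the other turns reflection into a translation (`shift`, `Linked.hits`). Each pair of
beams thus yields at most one piece, the overlap of the reflected source with the target.

The pieces have disjoint sources because the first reflection is unique (`target_unique`). They have
disjoint targets because two rays with the same image travel along the same line towards the same
point, and the one starting further back would first meet the origin of the other
(`beam_eq_of_hits`, `source_unique`). The numbering is injective because a start lies on exactly one
segment (`beam_eq_of_ray_eq`). It contains every reflected image of a numbered ray (`Hits.starts`,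
`exists_beam`), so a ray outside the domain is absorbed or escapes.

For the running time, `PT` is closed under composition, pairing, branching and folds over lists with
polynomially bounded state; the algorithm is a composition of these. -/

theorem natSize_add_le (a b : ℕ) : Nat.size (a + b) ≤ Nat.size a + Nat.size b := by
  rcases Nat.eq_zero_or_pos a with rfl | ha
  · simp
  rcases Nat.eq_zero_or_pos b with rfl | hb
  · simp
  have h1 := Nat.lt_size_self a
  have h2 := Nat.lt_size_self b
  rw [Nat.size_le, pow_add]
  have h3 : a + 1 ≤ 2 ^ Nat.size a := h1
  have h4 : b + 1 ≤ 2 ^ Nat.size b := h2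
  nlinarith [Nat.mul_le_mul h3 h4]

theorem natSize_mul_le (a b : ℕ) : Nat.size (a * b) ≤ Nat.size a + Nat.size b := by
  rw [Nat.size_le, pow_add]
  exact Nat.mul_lt_mul'' (Nat.lt_size_self a) (Nat.lt_size_self b)

theorem natSize_natAbs_add_le (a b : ℤ) :
    Nat.size (a + b).natAbs ≤ Nat.size a.natAbs + Nat.size b.natAbs :=
  (Nat.size_le_size (Int.natAbs_add_le a b)).trans (natSize_add_le _ _)

theorem natSize_natAbs_sub_le (a b : ℤ) :
    Nat.size (a - b).natAbs ≤ Nat.size a.natAbs + Nat.size b.natAbs :=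
  (Nat.size_le_size (Int.natAbs_sub_le a b)).trans (natSize_add_le _ _)

/-- Every step is charged for what it writes. This bounds the input of the second program in a
composition, so that polynomial time bounds can be composed. -/
theorem Runs.size_le {p : Prog} {x y : Data} {t : ℕ} (h : Runs p x y t) : y.size ≤ t := by
  induction h with
  | prim o x => omega
  | pair _ _ ih1 ih2 => omega
  | seq _ _ ih1 ih2 => omega
  | ite_true _ _ _ ih1 ih2 => omega
  | ite_false _ _ ih1 ih2 => omega
  | loop_done _ ih => omega
  | loop_step _ _ _ _ ih1 ih2 ih3 => omega

theorem polyEval_mono (T : Polynomial ℕ) {m n : ℕ} (h : m ≤ n) : T.eval m ≤ T.eval n := by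
  rw [Polynomial.eval_eq_sum_range, Polynomial.eval_eq_sum_range]
  gcongr

/-! ### Typed encodings and functions computable in polynomial time -/

/-- A type whose elements are encoded as values. -/
class Enc (α : Type) where
  enc : α → Data

open Enc

instance : Enc ℤ := ⟨.int⟩
instance : Enc ℕ := ⟨encNat⟩
instance : Enc Bool := ⟨encBool⟩
instance {α β : Type} [Enc α] [Enc β] : Enc (α × β) := ⟨fun x => .pair (enc x.1) (enc x.2)⟩
instance {α : Type} [Enc α] : Enc (List α) := ⟨encList enc⟩
instance : Enc MirrorSegment := ⟨MirrorSegment.encode⟩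
instance : Enc Environment := ⟨Environment.encode⟩
instance : Enc Piece := ⟨Piece.encode⟩
instance : Enc Block := ⟨Block.encode⟩

/-- The size of the encoding. -/
def esize {α : Type} [Enc α] (a : α) : ℕ := (enc a).size

/-- `f` is computed by a program in polynomial time. -/
@[fun_prop]
def PT {α β : Type} [Enc α] [Enc β] (f : α → β) : Prop :=
  ∃ (p : Prog) (T : Polynomial ℕ), ∀ a, ∃ t, t ≤ T.eval (esize a) ∧ Runs p (enc a) (enc (f a)) t

section Sizes

variable {α β : Type} [Enc α] [Enc β]

theorem esize_pair (a : α) (b : β) : esize (a, b) = 1 + esize a + esize b := rfl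

theorem esize_nil : esize ([] : List α) = 1 := by
  simp [esize, enc, encList, Data.size]

theorem esize_cons (a : α) (l : List α) : esize (a :: l) = 1 + esize a + esize l := rfl

theorem esize_append (l m : List α) : esize (l ++ m) + 1 = esize l + esize m := by
  induction l with
  | nil => simp [esize_nil, add_comm]
  | cons a l ih => simp only [List.cons_append, esize_cons]; omega

theorem esize_reverse (l : List α) : esize l.reverse = esize l := by
  induction l with
  | nil => rfl
  | cons a l ih =>
    have := esize_append l.reverse [a]
    simp only [List.reverse_cons, esize_cons, esize_nil] at *
    omega

theorem length_lt_esize (l : List α) : l.length < esize l := by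
  induction l with
  | nil => simp [esize_nil]
  | cons a l ih => simp only [List.length_cons, esize_cons]; omega

theorem esize_le_of_mem {a : α} {l : List α} (h : a ∈ l) : esize a < esize l := by
  induction l with
  | nil => simp at h
  | cons b l ih =>
    rw [esize_cons]
    rcases List.mem_cons.1 h with rfl | h
    · omega
    · have := ih h; omega

theorem esize_pos (a : α) : 0 < esize a := by
  unfold esize
  cases enc a <;> simp [Data.size]

theorem esize_bool_le (b : Bool) : esize b ≤ 2 := by
  cases b <;> simp [esize, enc, encBool, Data.size]

theorem PT.size_le {f : α → β} (h : PT f) :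
    ∃ T : Polynomial ℕ, ∀ a, esize (f a) ≤ T.eval (esize a) := by
  obtain ⟨p, T, h⟩ := h
  refine ⟨T, fun a => ?_⟩
  obtain ⟨t, ht, hr⟩ := h a
  exact hr.size_le.trans ht

end Sizes

namespace PT

variable {Γ α β γ σ : Type} [Enc Γ] [Enc α] [Enc β] [Enc γ] [Enc σ]

theorem of_prim (o : Prim) {f : α → β} (C : ℕ) (h : ∀ a, o.apply (enc a) = enc (f a))
    (hC : ∀ a, esize (f a) ≤ esize a + C) : PT f := by
  refine ⟨.prim o, Polynomial.C (1 + C) + 2 * Polynomial.X, fun a =>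
    ⟨1 + esize a + esize (f a), ?_, ?_⟩⟩
  · have := hC a
    simp
    omega
  · have := Runs.prim o (enc a)
    rw [h] at this
    exact this

@[fun_prop]
theorem comp {f : α → β} {g : β → γ} (hg : PT g) (hf : PT f) : PT (fun a => g (f a)) := by
  obtain ⟨p, S, hp⟩ := hf
  obtain ⟨q, T, hq⟩ := hg
  refine ⟨.seq p q, S + T.comp S + 1, fun a => ?_⟩
  obtain ⟨s, hs, hsr⟩ := hp a
  obtain ⟨t, ht, htr⟩ := hq (f a)
  refine ⟨_, ?_, Runs.seq hsr htr⟩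
  have := polyEval_mono T (hsr.size_le.trans hs)
  simp [Polynomial.eval_comp]
  exact Nat.add_le_add hs (ht.trans this)

@[fun_prop]
theorem pair {f : α → β} {g : α → γ} (hf : PT f) (hg : PT g) : PT (fun a => (f a, g a)) := by
  obtain ⟨p, S, hp⟩ := hf
  obtain ⟨q, T, hq⟩ := hg
  refine ⟨.pair p q, 2 * S + 2 * T + Polynomial.X + 2, fun a => ?_⟩
  obtain ⟨s, hs, hsr⟩ := hp a
  obtain ⟨t, ht, htr⟩ := hq a
  refine ⟨_, ?_, Runs.pair hsr htr⟩
  have h1 := hsr.size_le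
  have h2 := htr.size_le
  simp only [Data.size, Polynomial.eval_add, Polynomial.eval_mul, Polynomial.eval_X,
    Polynomial.eval_ofNat]
  unfold esize at *
  omega

/-- The same program serves for types with the same encodings. -/
theorem of_enc {f : α → β} {g : α → γ} (hf : PT f) (h : ∀ a, enc (g a) = enc (f a)) : PT g := by
  obtain ⟨p, S, hp⟩ := hf
  refine ⟨p, S, fun a => ?_⟩
  rw [h]
  exact hp a

/-- Serves for the fields of a structure, which is encoded like the nested tuple of its fields. -/
theorem of_enc_dom {f : α → β} {g : γ → β} (hf : PT f) (e : γ → α)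
    (he : ∀ a, (enc a : Data) = enc (e a)) (h : ∀ a, g a = f (e a)) : PT g := by
  obtain ⟨p, S, hp⟩ := hf
  refine ⟨p, S, fun a => ?_⟩
  obtain ⟨t, ht, hr⟩ := hp (e a)
  refine ⟨t, ?_, ?_⟩
  · unfold esize at *
    rw [he]
    exact ht
  · rw [he, h]
    exact hr

@[fun_prop]
theorem id : PT (fun a : α => a) := of_prim .id 0 (fun _ => rfl) (fun _ => le_rfl)

@[fun_prop]
theorem fst {f : Γ → α × β} (hf : PT f) : PT (fun x => (f x).1) :=
  comp (g := Prod.fst) (of_prim .fst 0 (fun _ => rfl)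
    (fun a => by obtain ⟨a, b⟩ := a; rw [esize_pair]; simp; omega)) hf

@[fun_prop]
theorem snd {f : Γ → α × β} (hf : PT f) : PT (fun x => (f x).2) :=
  comp (g := Prod.snd) (of_prim .snd 0 (fun _ => rfl)
    (fun a => by obtain ⟨a, b⟩ := a; rw [esize_pair]; simp)) hf

@[fun_prop]
theorem const (a : α) : PT (fun _ : Γ => a) := by
  -- Only integer constants are primitive, so the program is assembled along the structure of the
  -- value; its time is linear in the ignored input, which still has to be read.
  have h : ∀ y : Data, ∃ (p : Prog) (C : ℕ), ∀ x, ∃ t, t ≤ C * (x.size + 1) ∧ Runs p x y t := by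
    intro y
    induction y with
    | int z =>
      refine ⟨.prim (.const z), 1 + (Data.int z).size, fun x => ⟨_, ?_, Runs.prim _ x⟩⟩
      simp only [Prim.apply]
      nlinarith [Nat.zero_le (x.size * (Data.int z).size)]
    | pair y z hy hz =>
      obtain ⟨p, C, hp⟩ := hy
      obtain ⟨q, D, hq⟩ := hz
      refine ⟨.pair p q, C + D + 1 + (Data.pair y z).size, fun x => ?_⟩
      obtain ⟨s, hs, hsr⟩ := hp x
      obtain ⟨t, ht, htr⟩ := hq x
      refine ⟨_, ?_, Runs.pair hsr htr⟩
      nlinarith [Nat.zero_le (x.size * (Data.pair y z).size)]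
  obtain ⟨p, C, hp⟩ := h (enc a)
  refine ⟨p, Polynomial.C C * (Polynomial.X + 1), fun x => ?_⟩
  simpa [esize] using hp (enc x)

@[fun_prop]
theorem add {f g : Γ → ℤ} (hf : PT f) (hg : PT g) : PT (fun x => f x + g x) :=
  comp (g := fun x : ℤ × ℤ => x.1 + x.2) (of_prim .add 0 (fun _ => rfl) (fun a => by
    have := natSize_natAbs_add_le a.1 a.2
    simp [esize, enc, Data.size]; omega)) (pair hf hg)

@[fun_prop]
theorem sub {f g : Γ → ℤ} (hf : PT f) (hg : PT g) : PT (fun x => f x - g x) :=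
  comp (g := fun x : ℤ × ℤ => x.1 - x.2) (of_prim .sub 0 (fun _ => rfl) (fun a => by
    have := natSize_natAbs_sub_le a.1 a.2
    simp [esize, enc, Data.size]; omega)) (pair hf hg)

@[fun_prop]
theorem mul {f g : Γ → ℤ} (hf : PT f) (hg : PT g) : PT (fun x => f x * g x) :=
  comp (g := fun x : ℤ × ℤ => x.1 * x.2) (of_prim .mul 0 (fun _ => rfl) (fun a => by
    have := natSize_mul_le a.1.natAbs a.2.natAbs
    simp [esize, enc, Data.size, Int.natAbs_mul]; omega)) (pair hf hg)

@[fun_prop]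
theorem div {f g : Γ → ℤ} (hf : PT f) (hg : PT g) : PT (fun x => f x / g x) :=
  comp (g := fun x : ℤ × ℤ => x.1 / x.2) (of_prim .div 0 (fun _ => rfl) (fun a => by
    have := Nat.size_le_size (Int.natAbs_ediv_le_natAbs a.1 a.2)
    simp [esize, enc, Data.size]; omega)) (pair hf hg)

@[fun_prop]
theorem neg {f : Γ → ℤ} (hf : PT f) : PT (fun x => -f x) := by
  simpa using sub (const 0) hf

/-- Decidability instances are kept arbitrary in these rules, so that they apply whichever instance
a definition happens to use. -/
theorem decide_inst {p : Γ → Prop} {i j : ∀ x, Decidable (p x)}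
    (h : PT (fun x => @decide (p x) (i x))) : PT (fun x => @decide (p x) (j x)) := by
  rwa [Subsingleton.elim j i]

@[fun_prop]
theorem lt {f g : Γ → ℤ} {i : ∀ x, Decidable (f x < g x)} (hf : PT f) (hg : PT g) :
    PT (fun x => @decide (f x < g x) (i x)) :=
  decide_inst (comp (g := fun x : ℤ × ℤ => decide (x.1 < x.2)) (of_prim .lt 2
    (fun a => by simp [enc, encBool, Prim.apply])
    (fun a => (esize_bool_le _).trans (by omega))) (pair hf hg))

theorem ite {c : Γ → Bool} {f g : Γ → α} (hc : PT c) (hf : PT f) (hg : PT g) :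
    PT (fun x => if c x = true then f x else g x) := by
  obtain ⟨p, S, hp⟩ := hc
  obtain ⟨q, T, hq⟩ := hf
  obtain ⟨r, U, hr⟩ := hg
  refine ⟨.ite p q r, S + T + U + Polynomial.X + 1, fun a => ?_⟩
  obtain ⟨s, hs, hsr⟩ := hp a
  simp only [Polynomial.eval_add, Polynomial.eval_X, Polynomial.eval_one]
  cases h : c a
  · rw [h] at hsr
    obtain ⟨t, ht, htr⟩ := hr a
    refine ⟨_, ?_, Runs.ite_false hsr (by simpa using htr)⟩
    unfold esize at *
    omega
  · rw [h] at hsr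
    obtain ⟨t, ht, htr⟩ := hq a
    refine ⟨_, ?_, Runs.ite_true hsr (by simp [enc, encBool]) (by simpa using htr)⟩
    unfold esize at *
    omega

@[fun_prop]
theorem and {f g : Γ → Bool} (hf : PT f) (hg : PT g) : PT (fun x => f x && g x) := by
  have := ite hf hg (const false)
  refine of_enc this (fun a => ?_)
  cases f a <;> simp

@[fun_prop]
theorem or {f g : Γ → Bool} (hf : PT f) (hg : PT g) : PT (fun x => f x || g x) := by
  have := ite hf (const true) hg
  refine of_enc this (fun a => ?_)
  cases f a <;> simp

@[fun_prop]
theorem not {f : Γ → Bool} (hf : PT f) : PT (fun x => !f x) := by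
  have := ite hf (const false) (const true)
  refine of_enc this (fun a => ?_)
  cases f a <;> simp

@[fun_prop]
theorem decAnd {f g : Γ → Prop} {i : ∀ x, Decidable (f x ∧ g x)} [∀ x, Decidable (f x)]
    [∀ x, Decidable (g x)] (hf : PT fun x => decide (f x)) (hg : PT fun x => decide (g x)) :
    PT (fun x => @decide (f x ∧ g x) (i x)) :=
  of_enc (and hf hg) (fun a => by simp)

@[fun_prop]
theorem decOr {f g : Γ → Prop} {i : ∀ x, Decidable (f x ∨ g x)} [∀ x, Decidable (f x)]
    [∀ x, Decidable (g x)] (hf : PT fun x => decide (f x)) (hg : PT fun x => decide (g x)) :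
    PT (fun x => @decide (f x ∨ g x) (i x)) :=
  of_enc (or hf hg) (fun a => by simp)

@[fun_prop]
theorem decNot {f : Γ → Prop} {i : ∀ x, Decidable (¬ f x)} [∀ x, Decidable (f x)]
    (hf : PT fun x => decide (f x)) : PT (fun x => @decide (¬ f x) (i x)) :=
  of_enc (not hf) (fun a => by simp)

@[fun_prop]
theorem decImp {f g : Γ → Prop} {i : ∀ x, Decidable (f x → g x)} [∀ x, Decidable (f x)]
    [∀ x, Decidable (g x)] (hf : PT fun x => decide (f x)) (hg : PT fun x => decide (g x)) :
    PT (fun x => @decide (f x → g x) (i x)) :=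
  of_enc (or (not hf) hg) (fun a => by by_cases f a <;> simp_all)

theorem decide_iff {p q : Γ → Prop} {i : ∀ x, Decidable (q x)} [∀ x, Decidable (p x)]
    (h : PT (fun x => decide (p x))) (e : ∀ x, q x ↔ p x) :
    PT (fun x => @decide (q x) (i x)) :=
  of_enc h (fun x => by simp [e])

@[fun_prop]
theorem le {f g : Γ → ℤ} {i : ∀ x, Decidable (f x ≤ g x)} (hf : PT f) (hg : PT g) :
    PT (fun x => @decide (f x ≤ g x) (i x)) :=
  decide_iff (decNot (i := fun _ => inferInstance) (lt (i := fun _ => inferInstance) hg hf))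
    (fun _ => _root_.not_lt.symm)

@[fun_prop]
theorem eqInt {f g : Γ → ℤ} {i : ∀ x, Decidable (f x = g x)} (hf : PT f) (hg : PT g) :
    PT (fun x => @decide (f x = g x) (i x)) :=
  decide_iff (decAnd (i := fun _ => inferInstance) (le (i := fun _ => inferInstance) hf hg)
    (le (i := fun _ => inferInstance) hg hf)) (fun _ => Int.le_antisymm_iff)

@[fun_prop]
theorem eqBool {f g : Γ → Bool} {i : ∀ x, Decidable (f x = g x)} (hf : PT f) (hg : PT g) :
    PT (fun x => @decide (f x = g x) (i x)) := by
  refine of_enc (ite hf hg (not hg)) (fun a => congrArg enc ?_)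
  by_cases h : f a = g a
  · simp only [h, decide_true]
    cases g a <;> rfl
  · simp only [h, decide_false]
    revert h
    cases f a <;> cases g a <;> simp

@[fun_prop]
theorem eqPair {δ ε : Type} {f g : Γ → δ × ε} {i : ∀ x, Decidable (f x = g x)}
    [∀ x, Decidable ((f x).1 = (g x).1)] [∀ x, Decidable ((f x).2 = (g x).2)]
    (h1 : PT (fun x => decide ((f x).1 = (g x).1)))
    (h2 : PT (fun x => decide ((f x).2 = (g x).2))) :
    PT (fun x => @decide (f x = g x) (i x)) :=
  decide_iff (decAnd (i := fun _ => inferInstance) h1 h2) (fun _ => Prod.ext_iff)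

@[fun_prop]
theorem iteProp {c : Γ → Prop} {i : ∀ x, Decidable (c x)} {f g : Γ → α}
    (hc : PT fun x => @decide (c x) (i x)) (hf : PT f) (hg : PT g) :
    PT (fun x => @_root_.ite α (c x) (i x) (f x) (g x)) :=
  of_enc (ite hc hf hg) (fun a => by by_cases c a <;> simp_all)

@[fun_prop]
theorem toNat {f : Γ → ℤ} (hf : PT f) : PT (fun x => (f x).toNat) := by
  refine of_enc (iteProp (lt (i := fun _ => inferInstance) hf (const 0)) (const 0) hf) (fun a => ?_)
  split_ifs with h
  · simp [enc, encNat, h.le]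
  · simp [enc, encNat]; omega

@[fun_prop]
theorem cons {f : Γ → α} {g : Γ → List α} (hf : PT f) (hg : PT g) : PT (fun x => f x :: g x) :=
  of_enc (pair hf hg) (fun _ => rfl)

end PT

namespace PT

variable {Γ α β γ σ : Type} [Enc Γ] [Enc α] [Enc β] [Enc γ] [Enc σ]

/-! ### Loops over lists -/

/-- The test of the loop that folds a list: is there an element left? -/
def foldTest : Prog := .seq (.prim .snd) (.seq (.prim .fst) (.prim .isPair))

/-- The body of the loop that folds a list with the program `p`. -/
def foldBody (p : Prog) : Prog :=
  .pair (.prim .fst) (.pair (.seq (.prim .snd) (.seq (.prim .fst) (.prim .snd)))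
    (.seq (.pair (.pair (.prim .fst) (.seq (.prim .snd) (.seq (.prim .fst) (.prim .fst))))
      (.seq (.prim .snd) (.prim .snd))) p))

/-- The loop runs on the triple of parameter, remaining list and state. If `N` bounds all three
throughout, the input of `p` has size at most `3 * N + 2`, and the projections and pairings of one
round cost at most the generous `100 * (N + 1)`. -/
theorem foldLoop_runs {p : Prog} {T : Polynomial ℕ} {f : (Γ × β) × σ → σ}
    (hp : ∀ a, ∃ t, t ≤ T.eval (esize a) ∧ Runs p (enc a) (enc (f a)) t) (x : Γ) (N : ℕ)
    (hx : esize x ≤ N) (l : List β) (s : σ) (hl : esize l ≤ N)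
    (hs : ∀ m, m <+: l → esize (m.foldl (fun s b => f ((x, b), s)) s) ≤ N) :
    ∃ t, t ≤ (l.length + 1) * (100 * (N + 1) + T.eval (3 * N + 2)) ∧
      Runs (.loop foldTest (foldBody p)) (enc (x, (l, s)))
        (enc (x, (([] : List β), l.foldl (fun s b => f ((x, b), s)) s))) t := by
  induction l generalizing s with
  | nil =>
    have h0 : esize s ≤ N := hs [] List.prefix_rfl
    refine ⟨_, ?_, Runs.loop_done (Runs.seq (Runs.prim _ _) (Runs.seq (Runs.prim _ _)
      (Runs.prim _ _)))⟩
    simp only [esize, enc, encList, Prim.apply, Data.size] at *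
    simp
    omega
  | cons b l ih =>
    have h0 : esize s ≤ N := hs [] (List.nil_prefix)
    have h1 : esize (f ((x, b), s)) ≤ N := hs [b] ⟨l, rfl⟩
    rw [esize_cons] at hl
    obtain ⟨t, ht, htr⟩ := hp ((x, b), s)
    obtain ⟨u, hu, hur⟩ := ih (f ((x, b), s)) (by omega) (fun m ⟨k, hk⟩ => by
      simpa using hs (b :: m) ⟨k, by simp [hk]⟩)
    have ht' : t ≤ T.eval (3 * N + 2) := ht.trans (polyEval_mono T (by
      rw [esize_pair, esize_pair]; omega))
    refine ⟨_, ?_, Runs.loop_step (b := .int 1) (y := enc (x, (l, f ((x, b), s))))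
      (Runs.seq (Runs.prim _ _) (Runs.seq (Runs.prim _ _) (Runs.prim _ _))) (by simp)
      (Runs.pair (Runs.prim _ _) (Runs.pair
        (Runs.seq (Runs.prim _ _) (Runs.seq (Runs.prim _ _) (Runs.prim _ _)))
        (Runs.seq (Runs.pair (Runs.pair (Runs.prim _ _)
            (Runs.seq (Runs.prim _ _) (Runs.seq (Runs.prim _ _) (Runs.prim _ _))))
          (Runs.seq (Runs.prim _ _) (Runs.prim _ _))) htr))) hur⟩
    have e1 : (l.length + 1 + 1) * (100 * (N + 1) + T.eval (3 * N + 2)) =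
        (l.length + 1) * (100 * (N + 1) + T.eval (3 * N + 2)) +
          (100 * (N + 1) + T.eval (3 * N + 2)) := by ring
    rw [List.length_cons, e1]
    generalize (l.length + 1) * (100 * (N + 1) + T.eval (3 * N + 2)) = W at *
    generalize T.eval (3 * N + 2) = V at *
    simp only [esize, enc, encList, Prim.apply, Data.size] at *
    simp
    omega

/-- A loop over a list takes polynomial time if the state remains of polynomial size. -/
theorem foldl {l : Γ → List β} {s : Γ → σ} {f : Γ → σ → β → σ} (hl : PT l) (hs : PT s)
    (hf : PT (fun p : (Γ × β) × σ => f p.1.1 p.2 p.1.2))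
    (hb : ∃ S : Polynomial ℕ, ∀ x (m : List β),
      esize (m.foldl (f x) (s x)) ≤ S.eval (esize x + esize m)) :
    PT (fun x => (l x).foldl (f x) (s x)) := by
  obtain ⟨p, T, hp⟩ := hf
  obtain ⟨q, U, hq⟩ := pair (id (α := Γ)) (pair hl hs)
  obtain ⟨S, hS⟩ := hb
  obtain ⟨L, hL⟩ := hl.size_le
  -- A common bound for the parameter, the list and every intermediate state, used as `N` above.
  let B : Polynomial ℕ := Polynomial.X + L + S.comp (Polynomial.X + L)
  refine ⟨.seq q (.seq (.loop foldTest (foldBody p)) (.seq (.prim .snd) (.prim .snd))),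
    U + (L + 1) * (100 * (B + 1) + T.comp (3 * B + 2)) + 20 * (B + 1), fun x => ?_⟩
  obtain ⟨u, hu, hur⟩ := hq x
  have hB : B.eval (esize x) =
      esize x + L.eval (esize x) + S.eval (esize x + L.eval (esize x)) := by
    simp [B, Polynomial.eval_comp]
  have hLx := hL x
  have hpre : ∀ m, m <+: l x → esize (m.foldl (f x) (s x)) ≤ B.eval (esize x) := by
    rintro m ⟨k, hk⟩
    refine (hS x m).trans ?_
    have h1 : esize m ≤ esize (l x) := by
      rw [← hk]
      have := esize_append m k
      have := esize_pos k
      omega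
    have := polyEval_mono S (m := esize x + esize m) (n := esize x + L.eval (esize x)) (by omega)
    rw [hB]
    omega
  obtain ⟨t, ht, htr⟩ : ∃ t, t ≤ ((l x).length + 1) *
      (100 * (B.eval (esize x) + 1) + T.eval (3 * B.eval (esize x) + 2)) ∧
      Runs (.loop foldTest (foldBody p)) (enc (x, (l x, s x)))
        (enc (x, (([] : List β), (l x).foldl (f x) (s x)))) t :=
    foldLoop_runs hp x (B.eval (esize x)) (by rw [hB]; omega) (l x) (s x)
      (by rw [hB]; omega) hpre
  refine ⟨_, ?_, Runs.seq hur (Runs.seq htr (Runs.seq (Runs.prim _ _) (Runs.prim _ _)))⟩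
  have hlen := length_lt_esize (l x)
  have hfin := hpre (l x) List.prefix_rfl
  have hmul : ((l x).length + 1) *
      (100 * (B.eval (esize x) + 1) + T.eval (3 * B.eval (esize x) + 2)) ≤
      (L.eval (esize x) + 1) *
        (100 * (B.eval (esize x) + 1) + T.eval (3 * B.eval (esize x) + 2)) :=
    Nat.mul_le_mul_right _ (by omega)
  have hxB : esize x ≤ B.eval (esize x) := by rw [hB]; omega
  simp only [Polynomial.eval_add, Polynomial.eval_mul, Polynomial.eval_comp, Polynomial.eval_one,
    Polynomial.eval_ofNat]
  have ht' := ht.trans hmul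
  generalize (L.eval (esize x) + 1) * (100 * (B.eval (esize x) + 1) +
    T.eval (3 * B.eval (esize x) + 2)) = W at *
  clear hB
  simp only [esize, enc, encList, Prim.apply, Data.size] at *
  simp
  omega

/-- A fold builds its result by prepending, hence in reverse order. Reversal, append and `flatMap`
are all reduced to this operation. -/
theorem reverseAux {f g : Γ → List β} (hf : PT f) (hg : PT g) :
    PT (fun x => (f x).reverseAux (g x)) := by
  have e : ∀ l m : List β, l.foldl (fun s b => b :: s) m = l.reverseAux m := by
    intro l
    induction l with
    | nil => intro m; rfl
    | cons b l ih => intro m; exact ih _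
  obtain ⟨T, hT⟩ := hg.size_le
  have := foldl (f := fun (_ : Γ) (s : List β) (b : β) => b :: s) hf hg
    (cons (snd (fst id)) (snd id)) ⟨Polynomial.X + T, fun x m => by
      rw [e, List.reverseAux_eq]
      have h1 := esize_append m.reverse (g x)
      have h2 := hT x
      have h3 := polyEval_mono T (m := esize x) (n := esize x + esize m) (by omega)
      rw [esize_reverse] at h1
      simp
      omega⟩
  simpa only [e] using this

@[fun_prop]
theorem reverse {f : Γ → List β} (hf : PT f) : PT (fun x => (f x).reverse) := by
  simpa only [List.reverseAux_eq, List.append_nil] using reverseAux hf (const [])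

@[fun_prop]
theorem append {f g : Γ → List β} (hf : PT f) (hg : PT g) : PT (fun x => f x ++ g x) := by
  simpa only [List.reverseAux_eq, List.reverse_reverse] using reverseAux (reverse hf) hg

theorem esize_flatMap_le {δ : Type} (f : δ → List γ) (K : ℕ) (m : List δ)
    (h : ∀ b ∈ m, esize (f b) ≤ K) : esize (m.flatMap f) ≤ 1 + m.length * K := by
  induction m with
  | nil => simp [esize_nil]
  | cons b m ih =>
    have h1 := ih fun b' hb' => h b' (List.mem_cons_of_mem _ hb')
    have h2 := h b List.mem_cons_self
    have h3 := esize_append (f b) (m.flatMap f)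
    rw [List.flatMap_cons, List.length_cons, Nat.add_mul]
    omega

@[fun_prop]
theorem flatMap {l : Γ → List β} {f : Γ → β → List γ} (hl : PT l)
    (hf : PT (fun p : Γ × β => f p.1 p.2)) : PT (fun x => (l x).flatMap (f x)) := by
  have e : ∀ x (m : List β) s, m.foldl (fun s b => (f x b).reverseAux s) s =
      (m.flatMap (f x)).reverse ++ s := by
    intro x m
    induction m with
    | nil => intro s; rfl
    | cons b m ih =>
      intro s
      rw [List.foldl_cons, ih, List.flatMap_cons, List.reverse_append, List.reverseAux_eq,
        List.append_assoc]
  obtain ⟨T, hT⟩ := hf.size_le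
  have := foldl (f := fun (x : Γ) (s : List γ) (b : β) => (f x b).reverseAux s) hl (const [])
    (reverseAux (comp hf (fst id)) (snd id))
    ⟨1 + Polynomial.X * T.comp (Polynomial.X + 1), fun x m => by
      rw [e, List.append_nil, esize_reverse]
      refine (esize_flatMap_le _ (T.eval (esize x + esize m + 1)) m fun b hb =>
        (hT (x, b)).trans (polyEval_mono T ?_)).trans ?_
      · have := esize_le_of_mem hb
        rw [esize_pair]
        omega
      · have := length_lt_esize m
        simp only [Polynomial.eval_add, Polynomial.eval_mul, Polynomial.eval_comp,
          Polynomial.eval_one, Polynomial.eval_X]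
        gcongr
        omega⟩
  simpa only [e, List.append_nil, List.reverse_reverse] using reverse this

@[fun_prop]
theorem map {l : Γ → List β} {f : Γ → β → γ} (hl : PT l) (hf : PT (fun p : Γ × β => f p.1 p.2)) :
    PT (fun x => (l x).map (f x)) := by
  simpa only [← List.map_eq_flatMap] using flatMap (f := fun x b => [f x b]) hl (cons hf (const []))

@[fun_prop]
theorem filter {l : Γ → List β} {c : Γ → β → Bool} (hl : PT l)
    (hc : PT (fun p : Γ × β => c p.1 p.2)) : PT (fun x => (l x).filter (c x)) := by
  have e : ∀ x, (l x).flatMap (fun b => if c x b = true then [b] else []) = (l x).filter (c x) := by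
    intro x
    induction l x with
    | nil => rfl
    | cons b m ih => by_cases h : c x b <;> simp [h, ih]
  simpa only [e] using flatMap (f := fun x b => if c x b = true then [b] else []) hl
    (ite hc (cons (snd id) (const [])) (const []))

theorem all {l : Γ → List β} {c : Γ → β → Bool} (hl : PT l)
    (hc : PT (fun p : Γ × β => c p.1 p.2)) : PT (fun x => (l x).all (c x)) := by
  have e : ∀ x (m : List β) s, m.foldl (fun s b => s && c x b) s = (s && m.all (c x)) := by
    intro x m
    induction m with
    | nil => intro s; simp
    | cons b m ih => intro s; simp [ih, Bool.and_assoc]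
  have := foldl (f := fun (x : Γ) (s : Bool) (b : β) => s && c x b) hl (const true)
    (and (snd id) (comp hc (fst id))) ⟨2, fun x m => by
      simpa using esize_bool_le _⟩
  simpa only [e, Bool.true_and] using this

@[fun_prop]
theorem forallMem {l : Γ → List β} {c : Γ → β → Prop} {i : ∀ x, Decidable (∀ b ∈ l x, c x b)}
    [∀ x b, Decidable (c x b)] (hl : PT l) (hc : PT (fun p : Γ × β => decide (c p.1 p.2))) :
    PT (fun x => @decide (∀ b ∈ l x, c x b) (i x)) :=
  of_enc (all (c := fun x b => decide (c x b)) hl hc) (fun x => congrArg enc (by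
    rw [Bool.eq_iff_iff]; simp))

end PT

/-- The list without repetitions. -/
def dedup {β : Type} [DecidableEq β] (l : List β) : List β :=
  l.foldl (fun s b => if ∀ a ∈ s, a ≠ b then b :: s else s) []

section

variable {β : Type} [DecidableEq β]

theorem dedup_aux (l s : List β) (hs : s.Nodup) :
    (l.foldl (fun s b => if ∀ a ∈ s, a ≠ b then b :: s else s) s).Nodup ∧
    ∀ a, a ∈ l.foldl (fun s b => if ∀ a ∈ s, a ≠ b then b :: s else s) s ↔ a ∈ l ∨ a ∈ s := by
  induction l generalizing s with
  | nil => simp [hs]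
  | cons b l ih =>
    rw [List.foldl_cons]
    split_ifs with h
    · have h' : (b :: s).Nodup := List.nodup_cons.2 ⟨fun hb => h b hb rfl, hs⟩
      refine ⟨(ih _ h').1, fun a => ?_⟩
      rw [(ih _ h').2, List.mem_cons, List.mem_cons]
      tauto
    · push Not at h
      obtain ⟨c, hc, rfl⟩ := h
      refine ⟨(ih _ hs).1, fun a => ?_⟩
      rw [(ih _ hs).2, List.mem_cons]
      constructor
      · tauto
      · rintro ((rfl | h) | h) <;> tauto

theorem nodup_dedup (l : List β) : (dedup l).Nodup := (dedup_aux l [] List.nodup_nil).1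

theorem mem_dedup {l : List β} {a : β} : a ∈ dedup l ↔ a ∈ l := by
  have := (dedup_aux l [] List.nodup_nil).2 a
  rwa [or_iff_left List.not_mem_nil] at this

/-- The accumulator gains at most the element just read, so its size is bounded by that of the
consumed list. -/
theorem PT.dedup {Γ : Type} [Enc Γ] [Enc β] {f : Γ → List β} (hf : PT f)
    (he : PT (fun p : β × β => decide (p.1 = p.2))) : PT (fun x => dedup (f x)) := by
  have hb : ∀ (m s : List β), esize (m.foldl
      (fun s b => if ∀ a ∈ s, a ≠ b then b :: s else s) s) ≤ esize s + esize m := by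
    intro m
    induction m with
    | nil => intro s; simp
    | cons b m ih =>
      intro s
      have h1 := ih s
      have h2 := ih (b :: s)
      rw [List.foldl_cons]
      rw [esize_cons] at *
      split_ifs <;> omega
  refine foldl (f := fun (_ : Γ) (s : List β) (b : β) => if ∀ a ∈ s, a ≠ b then b :: s else s)
    hf (const []) (iteProp (forallMem (i := fun _ => inferInstance) (snd id) (decNot (comp he
      (pair (snd id) (snd (fst (fst id)))))))
      (cons (snd (fst id)) (snd id)) (snd id)) ⟨1 + Polynomial.X, fun x m => ?_⟩
  have := hb m []
  rw [esize_nil] at this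
  rw [Polynomial.eval_add, Polynomial.eval_one, Polynomial.eval_X]
  omega

end

/-! ### The algorithm -/

instance : DecidableEq MirrorSegment := fun s t =>
  decidable_of_iff ((s.a = t.a ∧ s.b = t.b) ∧ s.left = t.left ∧ s.right = t.right) (by
    cases s; cases t; simp [and_assoc])

instance : DecidableEq Piece := fun p q =>
  decidable_of_iff ((p.src : ℤ) = q.src ∧ (p.len : ℤ) = q.len ∧ (p.dst : ℤ) = q.dst) (by
    cases p; cases q; simp)

/-- The vector rotated by a right angle. -/
def perp (d : ℤ × ℤ) : ℤ × ℤ := (-d.2, d.1)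

/-- A line, given by one of its points and its direction, meets the line in direction `d` that
consists of the points `q` with `cross d q = c` in the point `crossNum d k c / crossDen d k`. -/
def crossNum (d : ℤ × ℤ) (k : (ℤ × ℤ) × (ℤ × ℤ)) (c : ℤ) : ℤ × ℤ :=
  (cross d k.2 * (cross d k.2 * k.1.1 + (c - cross d k.1) * k.2.1),
    cross d k.2 * (cross d k.2 * k.1.2 + (c - cross d k.1) * k.2.2))

/-- The square makes the denominator positive for transverse lines, so clearing it preserves signs;
`crossNum` carries the matching extra factor. -/
def crossDen (d : ℤ × ℤ) (k : (ℤ × ℤ) × (ℤ × ℤ)) : ℤ := cross d k.2 * cross d k.2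

/-- The sign tells on which side of the line through `p` and `q` the intersection point lies. -/
def sideForm (d : ℤ × ℤ) (k : (ℤ × ℤ) × (ℤ × ℤ)) (p q : ℤ × ℤ) (c : ℤ) : ℤ :=
  (q.1 - p.1) * ((crossNum d k c).2 - crossDen d k * p.2) -
    (q.2 - p.2) * ((crossNum d k c).1 - crossDen d k * p.1)

/-- The sign compares the first coordinates of the intersection point and `e`. -/
def fstForm (d : ℤ × ℤ) (k : (ℤ × ℤ) × (ℤ × ℤ)) (e : ℤ × ℤ) (c : ℤ) : ℤ :=
  (crossNum d k c).1 - crossDen d k * e.1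

/-- The sign compares the second coordinates of the intersection point and `e`. -/
def sndForm (d : ℤ × ℤ) (k : (ℤ × ℤ) × (ℤ × ℤ)) (e : ℤ × ℤ) (c : ℤ) : ℤ :=
  (crossNum d k c).2 - crossDen d k * e.2

/-- Positive if the intersection point with `k` comes before the one with `k'`. -/
def timeForm (d : ℤ × ℤ) (k k' : (ℤ × ℤ) × (ℤ × ℤ)) (c : ℤ) : ℤ :=
  dot d (crossNum d k' c) * crossDen d k - dot d (crossNum d k c) * crossDen d k'

/-- The intersection point lies on the segment with the endpoints `p` and `q`. -/
def CrossesAt (d : ℤ × ℤ) (k : (ℤ × ℤ) × (ℤ × ℤ)) (p q : ℤ × ℤ) (c : ℤ) : Prop :=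
  sideForm d k p q c = 0 ∧ fstForm d k p c * fstForm d k q c ≤ 0 ∧
    sndForm d k p c * sndForm d k q c ≤ 0

instance (d : ℤ × ℤ) (k : (ℤ × ℤ) × (ℤ × ℤ)) (p q : ℤ × ℤ) (c : ℤ) :
    Decidable (CrossesAt d k p q c) := by unfold CrossesAt; infer_instance

/-- The line through the segment. -/
def MirrorSegment.line (s : MirrorSegment) : (ℤ × ℤ) × (ℤ × ℤ) := (s.a, s.vec)

instance (s : MirrorSegment) (d : ℤ × ℤ) : Decidable (s.ReflectsFrom d) := by
  unfold MirrorSegment.ReflectsFrom; infer_instance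

/-- Something that moves in direction `d` may leave the segment on a reflective side. -/
def MirrorSegment.Emits (s : MirrorSegment) (d : ℤ × ℤ) : Prop :=
  (0 < cross s.vec d ∧ s.left = true) ∨ (cross s.vec d < 0 ∧ s.right = true)

instance (s : MirrorSegment) (d : ℤ × ℤ) : Decidable (s.Emits d) := by
  unfold MirrorSegment.Emits; infer_instance

/-- The mirror image of `d`, for a segment with vector `w`. -/
def mirror (w d : ℤ × ℤ) : ℤ × ℤ :=
  if w.2 = 0 then (d.1, -d.2) else if w.1 = 0 then (-d.1, d.2)
  else if w.1 = w.2 then (d.2, d.1) else (-d.2, -d.1)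

/-- A family of parallel rays of the same orientation that emanate from a segment: those whose
origins `q` satisfy `lo ≤ cross dir q < hi`. -/
structure Beam where
  seg : MirrorSegment
  dir : ℤ × ℤ
  orient : Bool
  lo : ℤ
  hi : ℤ

instance : Enc Beam := ⟨fun B => enc (B.seg, (B.dir, (B.orient, (B.lo, B.hi))))⟩

instance : DecidableEq Beam := fun B C =>
  decidable_of_iff (B.seg = C.seg ∧ B.dir = C.dir ∧ B.orient = C.orient ∧ B.lo = C.lo ∧
    B.hi = C.hi) (by cases B; cases C; simp)

namespace Beam

def len (B : Beam) : ℤ := B.hi - B.lo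

/-- The values of `cross dir q` increase along the block if the orientation is `true`, and decrease
otherwise. -/
def sgn (B : Beam) : ℤ := if B.orient = true then 1 else -1

/-- The value of `cross dir q` for the first ray. -/
def first (B : Beam) : ℤ := if B.orient = true then B.lo else B.hi - 1

def toBlock (B : Beam) : Block where
  len := B.len.toNat
  base := crossNum B.dir B.seg.line B.first
  step := ((crossNum B.dir B.seg.line (B.first + B.sgn)).1 - (crossNum B.dir B.seg.line B.first).1,
    (crossNum B.dir B.seg.line (B.first + B.sgn)).2 - (crossNum B.dir B.seg.line B.first).2)
  den := (crossDen B.dir B.seg.line).toNat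
  dir := B.dir
  orient := B.orient

end Beam

/-- The two integers around the zero of the affine function with values `u` at `0` and `v` at
`1`. -/
def rootBreaks (u v : ℤ) : List ℤ :=
  -- Expanding the fraction by `v - u` makes the denominator positive, so the quotient is the floor
  -- of the zero. For a constant function the division by `0` gives `0`, a harmless additional
  -- break.
  [-u * (v - u) / ((v - u) * (v - u)), -u * (v - u) / ((v - u) * (v - u)) + 1]

namespace Environment

variable (E : Environment)

def endpoints : List (ℤ × ℤ) := E.segments.flatMap fun s => [s.a, s.b]

def points : List (ℤ × ℤ) := E.start :: E.endpoints

/-- What a ray in direction `d` may meet: segments that are not parallel to it, endpoints of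
segments, and the start. Each is given by a line and a second endpoint on it. -/
def obstacles (d : ℤ × ℤ) : List (((ℤ × ℤ) × (ℤ × ℤ)) × (ℤ × ℤ)) :=
  (E.segments.filter fun s => decide (cross s.vec d ≠ 0)).map (fun s => (s.line, s.b)) ++
    (E.endpoints.map (fun e => ((e, perp d), e)) ++
      if d = E.dir then [((E.start, perp d), E.start)] else [])

/-- The rounded zeros of all affine forms whose signs enter `Clean`, `Starts` and `Hits`. The
positions of the points are added so that the cells cover every position on a segment; the `+ 1` is
needed because cells are half-open. -/
def breaks (d : ℤ × ℤ) : List ℤ :=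
  (E.points.flatMap fun e => [cross d e, cross d e + 1]) ++
    (E.obstacles d).flatMap fun o =>
      (E.segments.flatMap fun s =>
        rootBreaks (sideForm d o.1 s.a s.b 0) (sideForm d o.1 s.a s.b 1)) ++
      ((E.points.flatMap fun e =>
        rootBreaks (fstForm d o.1 e 0) (fstForm d o.1 e 1) ++
        rootBreaks (sndForm d o.1 e 0) (sndForm d o.1 e 1)) ++
      ((E.obstacles d).flatMap fun o' =>
        rootBreaks (timeForm d o.1 o'.1 0) (timeForm d o.1 o'.1 1)))

/-- The intervals between consecutive breaks. -/
def cells (d : ℤ × ℤ) : List (ℤ × ℤ) :=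
  (E.breaks d).flatMap fun lo => (E.breaks d).flatMap fun hi =>
    if lo < hi ∧ ∀ b ∈ E.breaks d, ¬ (lo < b ∧ b < hi) then [(lo, hi)] else []

/-- The line `cross d q = c` intersects the segment transversely in an inner point that lies on no
other segment. -/
def Clean (s : MirrorSegment) (d : ℤ × ℤ) (c : ℤ) : Prop :=
  cross s.vec d ≠ 0 ∧ CrossesAt d s.line s.a s.b c ∧
    (∀ e ∈ E.endpoints, ¬ CrossesAt d s.line e e c) ∧
    ∀ s' ∈ E.segments, s' ≠ s → ¬ CrossesAt d s.line s'.a s'.b c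

instance (s : MirrorSegment) (d : ℤ × ℤ) (c : ℤ) : Decidable (E.Clean s d c) := by
  unfold Clean; infer_instance

/-- The ray may emanate from the segment after a reflection. -/
def Starts (s : MirrorSegment) (d : ℤ × ℤ) (c : ℤ) : Prop :=
  E.Clean s d c ∧ s.Emits d ∧ ¬ (d = E.dir ∧ CrossesAt d s.line E.start E.start c)

instance (s : MirrorSegment) (d : ℤ × ℤ) (c : ℤ) : Decidable (E.Starts s d c) := by
  unfold Starts; infer_instance

/-- The ray that emanates from the segment `s` is first reflected at the segment `s'`. -/
def Hits (s : MirrorSegment) (d : ℤ × ℤ) (c : ℤ) (s' : MirrorSegment) : Prop :=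
  E.Clean s' d c ∧ 0 < timeForm d s.line s'.line c ∧
    (∀ o ∈ E.obstacles d, ¬ (CrossesAt d o.1 o.1.1 o.2 c ∧ 0 < timeForm d s.line o.1 c ∧
      0 < timeForm d o.1 s'.line c)) ∧
    s'.ReflectsFrom d ∧
    ¬ (CrossesAt d s'.line E.start E.start c ∧ (d = E.dir ∨ mirror s'.vec d = E.dir))

instance (s : MirrorSegment) (d : ℤ × ℤ) (c : ℤ) (s' : MirrorSegment) :
    Decidable (E.Hits s d c s') := by
  unfold Hits; infer_instance

/-- The initial ray. Its carrier is a segment without reflective sides that does not belong to the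
environment. -/
def startBeam : Beam where
  seg := ⟨E.start, (E.start.1 + (perp E.dir).1, E.start.2 + (perp E.dir).2), false, false⟩
  dir := E.dir
  orient := true
  lo := cross E.dir E.start
  hi := cross E.dir E.start + 1

/-- It suffices to test `Starts` at the lower end of a cell. Repetitions come from repeated breaks
and from coinciding directions, such as `x = y` or `x = 0`. The initial beam comes first, so the
initial ray gets number `0`. -/
def beams : List Beam :=
  E.startBeam :: dedup (E.segments.flatMap fun s => E.directions.flatMap fun d =>
    [true, false].flatMap fun o => (E.cells d).flatMap fun u =>
      if E.Starts s d u.1 then [⟨s, d, o, u.1, u.2⟩] else [])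

end Environment

/-- The beams with the numbers of their first rays. -/
def place (l : List Beam) : ℤ × List (ℤ × Beam) :=
  l.foldl (fun s B => (s.1 + B.len, (s.1, B) :: s.2)) (0, [])

/-- The difference of the indices within the beams of a ray in `B` and its image in `C`. -/
def shift (B C : Beam) : ℤ :=
  -- With `K` the inner sum of cross products, reflection sends position `c` to `K - c`. The
  -- reflected beam has the opposite sign, so solving `C.first - B.sgn * j = K - (B.first + B.sgn *
  -- i)` for `j` gives `i` plus this constant.
  B.sgn * (B.first + C.first - (cross C.dir C.seg.a + cross B.dir C.seg.a))

/-- The index range in `B` of the rays that are reflected into `C`. -/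
def overlap (B C : Beam) : ℤ × ℤ :=
  -- The maximum and minimum that express `0 ≤ i < B.len` together with `0 ≤ i + shift B C < C.len`.
  (if 0 < -shift B C then -shift B C else 0,
    if B.len < C.len - shift B C then B.len else C.len - shift B C)

namespace Environment

variable (E : Environment)

/-- The piece of the transformation that maps rays of the beam `x.2` to rays of `y.2`. -/
def piece (x y : ℤ × Beam) : List Piece :=
  if (y.2.orient = !x.2.orient) ∧ y.2.dir = mirror y.2.seg.vec x.2.dir ∧
      E.Hits x.2.seg x.2.dir x.2.lo y.2.seg ∧ (overlap x.2 y.2).1 < (overlap x.2 y.2).2 then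
    [⟨(x.1 + (overlap x.2 y.2).1).toNat, ((overlap x.2 y.2).2 - (overlap x.2 y.2).1).toNat,
      (y.1 + ((overlap x.2 y.2).1 + shift x.2 y.2)).toNat⟩]
  else []

def pieces : List Piece :=
  dedup ((place E.beams).2.flatMap fun x => (place E.beams).2.flatMap fun y => E.piece x y)

/-- The data of the output. -/
def outputData : (ℕ × List Piece) × (List Block × ℕ) :=
  (((place E.beams).1.toNat, E.pieces), (E.beams.map Beam.toBlock, 0))

end Environment

/-! ### Polynomial time of the geometric algorithm -/

namespace PT

variable {Γ : Type} [Enc Γ]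

@[fun_prop]
theorem segA {f : Γ → MirrorSegment} (hf : PT f) : PT (fun x => (f x).a) :=
  comp (g := MirrorSegment.a) (of_enc_dom (fst (fst id)) (fun s => ((s.a, s.b), (s.left, s.right)))
    (fun _ => rfl) (fun _ => rfl)) hf

@[fun_prop]
theorem segB {f : Γ → MirrorSegment} (hf : PT f) : PT (fun x => (f x).b) :=
  comp (g := MirrorSegment.b) (of_enc_dom (snd (fst id)) (fun s => ((s.a, s.b), (s.left, s.right)))
    (fun _ => rfl) (fun _ => rfl)) hf

@[fun_prop]
theorem segLeft {f : Γ → MirrorSegment} (hf : PT f) : PT (fun x => (f x).left) :=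
  comp (g := MirrorSegment.left) (of_enc_dom (fst (snd id))
    (fun s => ((s.a, s.b), (s.left, s.right))) (fun _ => rfl) (fun _ => rfl)) hf

@[fun_prop]
theorem segRight {f : Γ → MirrorSegment} (hf : PT f) : PT (fun x => (f x).right) :=
  comp (g := MirrorSegment.right) (of_enc_dom (snd (snd id))
    (fun s => ((s.a, s.b), (s.left, s.right))) (fun _ => rfl) (fun _ => rfl)) hf

@[fun_prop]
theorem envSegments {f : Γ → Environment} (hf : PT f) : PT (fun x => (f x).segments) :=
  comp (g := Environment.segments) (of_enc_dom (fst id)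
    (fun E => (E.segments, (E.start, E.dir))) (fun _ => rfl) (fun _ => rfl)) hf

@[fun_prop]
theorem envStart {f : Γ → Environment} (hf : PT f) : PT (fun x => (f x).start) :=
  comp (g := Environment.start) (of_enc_dom (fst (snd id))
    (fun E => (E.segments, (E.start, E.dir))) (fun _ => rfl) (fun _ => rfl)) hf

@[fun_prop]
theorem envDir {f : Γ → Environment} (hf : PT f) : PT (fun x => (f x).dir) :=
  comp (g := Environment.dir) (of_enc_dom (snd (snd id))
    (fun E => (E.segments, (E.start, E.dir))) (fun _ => rfl) (fun _ => rfl)) hf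

@[fun_prop]
theorem beamSeg {f : Γ → Beam} (hf : PT f) : PT (fun x => (f x).seg) :=
  comp (g := Beam.seg) (of_enc_dom (fst id)
    (fun B => (B.seg, (B.dir, (B.orient, (B.lo, B.hi))))) (fun _ => rfl) (fun _ => rfl)) hf

@[fun_prop]
theorem beamDir {f : Γ → Beam} (hf : PT f) : PT (fun x => (f x).dir) :=
  comp (g := Beam.dir) (of_enc_dom (fst (snd id))
    (fun B => (B.seg, (B.dir, (B.orient, (B.lo, B.hi))))) (fun _ => rfl) (fun _ => rfl)) hf

@[fun_prop]
theorem beamOrient {f : Γ → Beam} (hf : PT f) : PT (fun x => (f x).orient) :=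
  comp (g := Beam.orient) (of_enc_dom (fst (snd (snd id)))
    (fun B => (B.seg, (B.dir, (B.orient, (B.lo, B.hi))))) (fun _ => rfl) (fun _ => rfl)) hf

@[fun_prop]
theorem beamLo {f : Γ → Beam} (hf : PT f) : PT (fun x => (f x).lo) :=
  comp (g := Beam.lo) (of_enc_dom (fst (snd (snd (snd id))))
    (fun B => (B.seg, (B.dir, (B.orient, (B.lo, B.hi))))) (fun _ => rfl) (fun _ => rfl)) hf

@[fun_prop]
theorem beamHi {f : Γ → Beam} (hf : PT f) : PT (fun x => (f x).hi) :=
  comp (g := Beam.hi) (of_enc_dom (snd (snd (snd (snd id))))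
    (fun B => (B.seg, (B.dir, (B.orient, (B.lo, B.hi))))) (fun _ => rfl) (fun _ => rfl)) hf

@[fun_prop]
theorem mkSeg {a b : Γ → ℤ × ℤ} {l r : Γ → Bool} (ha : PT a) (hb : PT b) (hl : PT l) (hr : PT r) :
    PT (fun x => MirrorSegment.mk (a x) (b x) (l x) (r x)) :=
  of_enc (pair (pair ha hb) (pair hl hr)) (fun _ => rfl)

@[fun_prop]
theorem mkBeam {s : Γ → MirrorSegment} {d : Γ → ℤ × ℤ} {o : Γ → Bool} {l h : Γ → ℤ} (hs : PT s)
    (hd : PT d) (ho : PT o) (hl : PT l) (hh : PT h) :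
    PT (fun x => Beam.mk (s x) (d x) (o x) (l x) (h x)) :=
  of_enc (pair hs (pair hd (pair ho (pair hl hh)))) (fun _ => rfl)

@[fun_prop]
theorem mkPiece {s l d : Γ → ℕ} (hs : PT s) (hl : PT l) (hd : PT d) :
    PT (fun x => Piece.mk (s x) (l x) (d x)) :=
  of_enc (pair hs (pair hl hd)) (fun _ => rfl)

@[fun_prop]
theorem mkBlock {l e : Γ → ℕ} {b s d : Γ → ℤ × ℤ} {o : Γ → Bool} (hl : PT l) (hb : PT b)
    (hs : PT s) (he : PT e) (hd : PT d) (ho : PT o) :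
    PT (fun x => Block.mk (l x) (b x) (s x) (e x) (d x) (o x)) :=
  of_enc (pair hl (pair hb (pair hs (pair he (pair hd ho))))) (fun _ => rfl)

@[fun_prop]
theorem eqSeg {f g : Γ → MirrorSegment} {i : ∀ x, Decidable (f x = g x)} (hf : PT f) (hg : PT g) :
    PT (fun x => @decide (f x = g x) (i x)) := by
  refine decide_iff (p := fun x => ((f x).a = (g x).a ∧ (f x).b = (g x).b) ∧
    (f x).left = (g x).left ∧ (f x).right = (g x).right) ?_ (fun x => ?_)
  · fun_prop
  · cases f x; cases g x; simp [and_assoc]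

@[fun_prop]
theorem eqPiece {f g : Γ → Piece} {i : ∀ x, Decidable (f x = g x)} (hf : PT f) (hg : PT g) :
    PT (fun x => @decide (f x = g x) (i x)) := by
  have h := fun {f : Γ → Piece} (hf : PT f) => comp
    (g := fun p : Piece => ((p.src : ℤ), ((p.len : ℤ), (p.dst : ℤ))))
    (of_enc_dom id (fun p => ((p.src : ℤ), ((p.len : ℤ), (p.dst : ℤ)))) (fun _ => rfl)
      (fun _ => rfl)) hf
  refine decide_iff (p := fun x => ((f x).src : ℤ) = (g x).src ∧ ((f x).len : ℤ) = (g x).len ∧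
    ((f x).dst : ℤ) = (g x).dst) ?_ (fun x => ?_)
  · exact decAnd (eqInt (fst (h hf)) (fst (h hg))) (decAnd (eqInt (fst (snd (h hf)))
      (fst (snd (h hg)))) (eqInt (snd (snd (h hf))) (snd (snd (h hg)))))
  · cases f x; cases g x; simp

@[fun_prop]
theorem eqBeam {f g : Γ → Beam} {i : ∀ x, Decidable (f x = g x)} (hf : PT f) (hg : PT g) :
    PT (fun x => @decide (f x = g x) (i x)) := by
  refine decide_iff (p := fun x => (f x).seg = (g x).seg ∧ (f x).dir = (g x).dir ∧
    (f x).orient = (g x).orient ∧ (f x).lo = (g x).lo ∧ (f x).hi = (g x).hi) ?_ (fun x => ?_)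
  · fun_prop
  · cases f x; cases g x; simp

@[fun_prop]
theorem cross {f g : Γ → ℤ × ℤ} (hf : PT f) (hg : PT g) :
    PT (fun x => MirrorMaze.cross (f x) (g x)) := by
  unfold MirrorMaze.cross
  fun_prop

@[fun_prop]
theorem dot {f g : Γ → ℤ × ℤ} (hf : PT f) (hg : PT g) :
    PT (fun x => MirrorMaze.dot (f x) (g x)) := by
  unfold MirrorMaze.dot
  fun_prop

@[fun_prop]
theorem segVec {f : Γ → MirrorSegment} (hf : PT f) : PT (fun x => (f x).vec) := by
  have e : ∀ x, (f x).vec = ((f x).b.1 - (f x).a.1, (f x).b.2 - (f x).a.2) := fun _ => rfl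
  simp only [e]
  fun_prop

@[fun_prop]
theorem segLine {f : Γ → MirrorSegment} (hf : PT f) : PT (fun x => (f x).line) :=
  pair (segA hf) (segVec hf)

@[fun_prop]
theorem perp {f : Γ → ℤ × ℤ} (hf : PT f) : PT (fun x => MirrorMaze.perp (f x)) := by
  unfold MirrorMaze.perp
  fun_prop

section Forms

variable {d p q e : Γ → ℤ × ℤ} {k k' : Γ → (ℤ × ℤ) × (ℤ × ℤ)} {c : Γ → ℤ}

@[fun_prop]
theorem crossNum (hd : PT d) (hk : PT k) (hc : PT c) :
    PT (fun x => MirrorMaze.crossNum (d x) (k x) (c x)) := by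
  unfold MirrorMaze.crossNum
  fun_prop

@[fun_prop]
theorem crossDen (hd : PT d) (hk : PT k) :
    PT (fun x => MirrorMaze.crossDen (d x) (k x)) := by
  unfold MirrorMaze.crossDen
  fun_prop

@[fun_prop]
theorem sideForm (hd : PT d) (hk : PT k) (hp : PT p) (hq : PT q) (hc : PT c) :
    PT (fun x => MirrorMaze.sideForm (d x) (k x) (p x) (q x) (c x)) := by
  unfold MirrorMaze.sideForm
  fun_prop

@[fun_prop]
theorem fstForm (hd : PT d) (hk : PT k) (he : PT e) (hc : PT c) :
    PT (fun x => MirrorMaze.fstForm (d x) (k x) (e x) (c x)) := by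
  unfold MirrorMaze.fstForm
  fun_prop

@[fun_prop]
theorem sndForm (hd : PT d) (hk : PT k) (he : PT e) (hc : PT c) :
    PT (fun x => MirrorMaze.sndForm (d x) (k x) (e x) (c x)) := by
  unfold MirrorMaze.sndForm
  fun_prop

@[fun_prop]
theorem timeForm (hd : PT d) (hk : PT k) (hk' : PT k') (hc : PT c) :
    PT (fun x => MirrorMaze.timeForm (d x) (k x) (k' x) (c x)) := by
  unfold MirrorMaze.timeForm
  fun_prop

@[fun_prop]
theorem mirror (hd : PT d) (hp : PT p) : PT (fun x => MirrorMaze.mirror (d x) (p x)) := by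
  unfold MirrorMaze.mirror
  fun_prop

@[fun_prop]
theorem rootBreaks {u v : Γ → ℤ} (hu : PT u) (hv : PT v) :
    PT (fun x => MirrorMaze.rootBreaks (u x) (v x)) := by
  unfold MirrorMaze.rootBreaks
  fun_prop

end Forms

section Env

variable {E : Γ → Environment} {s s' : Γ → MirrorSegment} {d : Γ → ℤ × ℤ} {c : Γ → ℤ}

@[fun_prop]
theorem endpoints (hE : PT E) : PT (fun x => (E x).endpoints) := by
  unfold Environment.endpoints
  fun_prop

@[fun_prop]
theorem points (hE : PT E) : PT (fun x => (E x).points) := by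
  unfold Environment.points
  fun_prop

@[fun_prop]
theorem directions (hE : PT E) : PT (fun x => (E x).directions) := by
  unfold Environment.directions
  fun_prop

@[fun_prop]
theorem obstacles (hE : PT E) (hd : PT d) : PT (fun x => (E x).obstacles (d x)) := by
  unfold Environment.obstacles
  fun_prop

@[fun_prop]
theorem breaks (hE : PT E) (hd : PT d) : PT (fun x => (E x).breaks (d x)) := by
  unfold Environment.breaks
  fun_prop

end Env

end PT

namespace PT

variable {Γ : Type} [Enc Γ]

section Env

variable {E : Γ → Environment} {s s' : Γ → MirrorSegment} {d : Γ → ℤ × ℤ} {c : Γ → ℤ}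
  {A B : Γ → Beam} {u v : Γ → ℤ × Beam}

@[fun_prop]
theorem cells (hE : PT E) (hd : PT d) : PT (fun x => (E x).cells (d x)) := by
  unfold Environment.cells
  fun_prop

@[fun_prop]
theorem hits {i : ∀ x, Decidable ((E x).Hits (s x) (d x) (c x) (s' x))} (hE : PT E) (hs : PT s)
    (hd : PT d) (hc : PT c) (hs' : PT s') :
    PT (fun x => @decide ((E x).Hits (s x) (d x) (c x) (s' x)) (i x)) := by
  unfold Environment.Hits at i ⊢
  fun_prop

@[fun_prop]
theorem startBeam (hE : PT E) : PT (fun x => (E x).startBeam) := by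
  unfold Environment.startBeam
  fun_prop

@[fun_prop]
theorem beams (hE : PT E) : PT (fun x => (E x).beams) := by
  unfold Environment.beams
  exact cons (by fun_prop) (PT.dedup (by fun_prop) (by fun_prop))

@[fun_prop]
theorem beamLen (hB : PT B) : PT (fun x => (B x).len) := by
  unfold Beam.len
  fun_prop

@[fun_prop]
theorem beamSgn (hB : PT B) : PT (fun x => (B x).sgn) := by
  unfold Beam.sgn
  fun_prop

@[fun_prop]
theorem beamFirst (hB : PT B) : PT (fun x => (B x).first) := by
  unfold Beam.first
  fun_prop

@[fun_prop]
theorem beamToBlock (hB : PT B) : PT (fun x => (B x).toBlock) := by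
  unfold Beam.toBlock
  exact mkBlock (by fun_prop) (by fun_prop) (by fun_prop) (by fun_prop) (by fun_prop) (by fun_prop)

/-- Offsets are sums of beam lengths, and bit size is subadditive, so each offset is no larger than
the list of beams; listing one offset per beam costs a quadratic amount. -/
theorem esize_place_le (l : List Beam) :
    esize (place l).1 ≤ esize l ∧ esize (place l).2 ≤ 3 * esize l ^ 2 := by
  induction l using List.reverseRecOn with
  | nil =>
    have : place [] = (0, []) := rfl
    rw [this, esize_nil]
    exact ⟨le_rfl, by simp [esize_nil]⟩
  | append_singleton l B ih =>
    have e : place (l ++ [B]) = ((place l).1 + B.len, ((place l).1, B) :: (place l).2) := by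
      simp [place, List.foldl_append]
    have h1 := esize_append l [B]
    rw [esize_cons, esize_nil] at h1
    have h2 : esize ((place l).1 + B.len) ≤ esize (place l).1 + esize B := by
      have h3 := natSize_natAbs_add_le (place l).1 B.len
      have h4 := natSize_natAbs_sub_le B.hi B.lo
      have h5 : esize B = 1 + esize B.seg + (1 + esize B.dir + (1 + esize B.orient +
        (1 + esize B.lo + esize B.hi))) := rfl
      simp only [esize, enc, Data.size, Beam.len] at *
      omega
    have hB := esize_pos B
    rw [e]
    refine ⟨by dsimp only; omega, ?_⟩
    rw [esize_cons, esize_pair]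
    have h3 : esize (l ++ [B]) = esize l + esize B + 1 := by omega
    rw [h3]
    nlinarith [ih.1, ih.2]

@[fun_prop]
theorem place {l : Γ → List Beam} (hl : PT l) : PT (fun x => MirrorMaze.place (l x)) := by
  unfold MirrorMaze.place
  refine foldl (f := fun (_ : Γ) (s : ℤ × List (ℤ × Beam)) (B : Beam) =>
    (s.1 + B.len, (s.1, B) :: s.2)) hl (by fun_prop) (by fun_prop)
    ⟨1 + Polynomial.X + 3 * Polynomial.X ^ 2, fun x m => ?_⟩
  have h := esize_place_le m
  have h1 : esize m ≤ esize x + esize m := by omega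
  have h2 := Nat.pow_le_pow_left h1 2
  unfold MirrorMaze.place at h
  generalize List.foldl _ _ m = S at *
  obtain ⟨S1, S2⟩ := S
  rw [esize_pair]
  simp only [Polynomial.eval_add, Polynomial.eval_mul, Polynomial.eval_pow, Polynomial.eval_X,
    Polynomial.eval_one, Polynomial.eval_ofNat]
  dsimp only at h
  omega

@[fun_prop]
theorem shift (hA : PT A) (hB : PT B) : PT (fun x => MirrorMaze.shift (A x) (B x)) := by
  unfold MirrorMaze.shift
  fun_prop

@[fun_prop]
theorem piece (hE : PT E) (hu : PT u) (hv : PT v) : PT (fun x => (E x).piece (u x) (v x)) := by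
  unfold Environment.piece
  fun_prop

@[fun_prop]
theorem pieces (hE : PT E) : PT (fun x => (E x).pieces) := by
  unfold Environment.pieces
  exact PT.dedup (by fun_prop) (by fun_prop)

theorem outputData (hE : PT E) : PT (fun x => (E x).outputData) := by
  unfold Environment.outputData
  fun_prop

end Env

end PT

/-! ### The combinatorial situation is the same for all rays of a cell -/

/-- Let `f` be the floor of the zero. Since `f` and `f + 1` are not inside the cell, the cell lies
in `[f + 1, ∞)`, or below `f`, or is the single integer `f`. The last case is needed because the
zero may be `f` itself. -/
theorem sign_eq_of_rootBreaks {u v lo hi c c' : ℤ} (hb : ∀ b ∈ rootBreaks u v, ¬ (lo < b ∧ b < hi))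
    (h1 : lo ≤ c) (h2 : c < hi) (h1' : lo ≤ c') (h2' : c' < hi) :
    (u + c * (v - u)).sign = (u + c' * (v - u)).sign := by
  generalize hα : v - u = α
  rcases eq_or_ne α 0 with rfl | h0
  · simp
  have hpos : 0 < α * α := mul_self_pos.2 h0
  set f := -u * α / (α * α) with hf
  have b1 : ¬ (lo < f ∧ f < hi) := hb _ (by simp [rootBreaks, hα, hf])
  have b2 : ¬ (lo < f + 1 ∧ f + 1 < hi) := hb _ (by simp [rootBreaks, hα, hf])
  have f1 : f * (α * α) ≤ -u * α := Int.ediv_mul_le _ hpos.ne'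
  have f2 : -u * α < (f + 1) * (α * α) := Int.lt_ediv_add_one_mul_self _ hpos
  have key : ∀ x y : ℤ, 0 < α * x → 0 < α * y → x.sign = y.sign := by
    intro x y hx hy
    rcases lt_or_gt_of_ne h0 with h | h
    · rw [Int.sign_eq_neg_one_of_neg (by nlinarith), Int.sign_eq_neg_one_of_neg (by nlinarith)]
    · rw [Int.sign_eq_one_of_pos (by nlinarith), Int.sign_eq_one_of_pos (by nlinarith)]
  have up : ∀ x : ℤ, f + 1 ≤ x → 0 < α * (u + x * α) := by
    intro x hx
    nlinarith [mul_le_mul_of_nonneg_right hx hpos.le]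
  have down : ∀ x : ℤ, x < f → 0 < α * -(u + x * α) := by
    intro x hx
    have hx' : x + 1 ≤ f := hx
    nlinarith [mul_le_mul_of_nonneg_right hx' hpos.le]
  rcases le_or_gt (f + 1) lo with h | h
  · exact key _ _ (up _ (by omega)) (up _ (by omega))
  rcases le_or_gt hi f with h' | h'
  · have := key _ _ (down c (by omega)) (down c' (by omega))
    rwa [Int.sign_neg, Int.sign_neg, neg_inj] at this
  · have : c = c' := by omega
    rw [this]

theorem sideForm_eq (d : ℤ × ℤ) (k : (ℤ × ℤ) × (ℤ × ℤ)) (p q : ℤ × ℤ) (c : ℤ) :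
    sideForm d k p q c =
      sideForm d k p q 0 + c * (sideForm d k p q 1 - sideForm d k p q 0) := by
  unfold sideForm crossNum; ring

theorem fstForm_eq (d : ℤ × ℤ) (k : (ℤ × ℤ) × (ℤ × ℤ)) (e : ℤ × ℤ) (c : ℤ) :
    fstForm d k e c = fstForm d k e 0 + c * (fstForm d k e 1 - fstForm d k e 0) := by
  unfold fstForm crossNum; ring

theorem sndForm_eq (d : ℤ × ℤ) (k : (ℤ × ℤ) × (ℤ × ℤ)) (e : ℤ × ℤ) (c : ℤ) :
    sndForm d k e c = sndForm d k e 0 + c * (sndForm d k e 1 - sndForm d k e 0) := by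
  unfold sndForm crossNum; ring

theorem timeForm_eq (d : ℤ × ℤ) (k k' : (ℤ × ℤ) × (ℤ × ℤ)) (c : ℤ) :
    timeForm d k k' c = timeForm d k k' 0 + c * (timeForm d k k' 1 - timeForm d k k' 0) := by
  unfold timeForm crossNum dot; ring

theorem sideForm_self (d : ℤ × ℤ) (k : (ℤ × ℤ) × (ℤ × ℤ)) (p : ℤ × ℤ) (c : ℤ) :
    sideForm d k p p c = 0 := by
  simp [sideForm]

theorem mul_nonpos_congr {a b a' b' : ℤ} (h : a.sign = a'.sign) (h' : b.sign = b'.sign) :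
    a * b ≤ 0 ↔ a' * b' ≤ 0 := by
  rw [← not_lt, ← not_lt, ← Int.sign_eq_one_iff_pos, ← Int.sign_eq_one_iff_pos, Int.sign_mul,
    Int.sign_mul, h, h']

theorem pos_congr {a a' : ℤ} (h : a.sign = a'.sign) : 0 < a ↔ 0 < a' := by
  rw [← Int.sign_eq_one_iff_pos, ← Int.sign_eq_one_iff_pos, h]

theorem eq_zero_congr {a a' : ℤ} (h : a.sign = a'.sign) : a = 0 ↔ a' = 0 := by
  rw [← Int.sign_eq_zero_iff_zero (a := a), h, Int.sign_eq_zero_iff_zero]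

namespace Environment

variable {E : Environment}

theorem a_mem_endpoints {s : MirrorSegment} (hs : s ∈ E.segments) : s.a ∈ E.endpoints :=
  List.mem_flatMap.2 ⟨s, hs, by simp⟩

theorem b_mem_endpoints {s : MirrorSegment} (hs : s ∈ E.segments) : s.b ∈ E.endpoints :=
  List.mem_flatMap.2 ⟨s, hs, by simp⟩

theorem mem_points_of_mem_endpoints {e : ℤ × ℤ} (he : e ∈ E.endpoints) : e ∈ E.points :=
  List.mem_cons_of_mem _ he

theorem start_mem_points : E.start ∈ E.points := List.mem_cons_self

theorem mem_obstacles {d : ℤ × ℤ} {o : ((ℤ × ℤ) × (ℤ × ℤ)) × (ℤ × ℤ)} :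
    o ∈ E.obstacles d ↔ (∃ s ∈ E.segments, cross s.vec d ≠ 0 ∧ (s.line, s.b) = o) ∨
      (∃ e ∈ E.endpoints, ((e, perp d), e) = o) ∨
      (d = E.dir ∧ o = ((E.start, perp d), E.start)) := by
  unfold obstacles
  rw [List.mem_append, List.mem_append, List.mem_map, List.mem_map]
  refine or_congr ?_ (or_congr Iff.rfl ?_)
  · simp [and_assoc]
  · split_ifs with h <;> simp [h]

/-- The line carries an obstacle. -/
def IsLine (E : Environment) (d : ℤ × ℤ) (k : (ℤ × ℤ) × (ℤ × ℤ)) : Prop :=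
  ∃ o ∈ E.obstacles d, o.1 = k

theorem isLine_line {s : MirrorSegment} (hs : s ∈ E.segments) {d : ℤ × ℤ}
    (h : cross s.vec d ≠ 0) : E.IsLine d s.line :=
  ⟨(s.line, s.b), mem_obstacles.2 (.inl ⟨s, hs, h, rfl⟩), rfl⟩

theorem mem_cells {d : ℤ × ℤ} {u : ℤ × ℤ} :
    u ∈ E.cells d ↔ u.1 ∈ E.breaks d ∧ u.2 ∈ E.breaks d ∧ u.1 < u.2 ∧
      ∀ b ∈ E.breaks d, ¬ (u.1 < b ∧ b < u.2) := by
  unfold cells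
  simp only [List.mem_flatMap]
  constructor
  · rintro ⟨lo, hlo, hi, hhi, h⟩
    split_ifs at h with h'
    · obtain rfl := List.mem_singleton.1 h
      exact ⟨hlo, hhi, h'⟩
    · simp at h
  · rintro ⟨h1, h2, h3⟩
    exact ⟨u.1, h1, u.2, h2, by rw [if_pos h3]; exact List.mem_singleton_self u⟩

/-- The cells cover everything between the least and the greatest break. -/
theorem exists_cell {d : ℤ × ℤ} {c b b' : ℤ} (hb : b ∈ E.breaks d) (hb' : b' ∈ E.breaks d)
    (h : b ≤ c) (h' : c < b') : ∃ u ∈ E.cells d, u.1 ≤ c ∧ c < u.2 := by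
  obtain ⟨lo, hlo, hmax⟩ := ((E.breaks d).toFinset.filter (· ≤ c)).exists_max_image id
    ⟨b, by simp [hb, h]⟩
  obtain ⟨hi, hhi, hmin⟩ := ((E.breaks d).toFinset.filter (c < ·)).exists_min_image id
    ⟨b', by simp [hb', h']⟩
  simp only [Finset.mem_filter, List.mem_toFinset, id] at *
  refine ⟨(lo, hi), mem_cells.2 ⟨hlo.1, hhi.1, by dsimp only; omega, fun x hx ⟨h1, h2⟩ => ?_⟩,
    hlo.2, hhi.2⟩
  dsimp only at *
  rcases le_or_gt x c with h3 | h3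
  · have := hmax x ⟨hx, h3⟩; omega
  · have := hmin x ⟨hx, h3⟩; omega

/-- Two different overlapping cells would have an end of one strictly inside the other, but ends are
breaks. -/
theorem cell_unique {d : ℤ × ℤ} {c : ℤ} {u v : ℤ × ℤ} (hu : u ∈ E.cells d) (hv : v ∈ E.cells d)
    (h1 : u.1 ≤ c) (h2 : c < u.2) (h3 : v.1 ≤ c) (h4 : c < v.2) : u = v := by
  rw [mem_cells] at hu hv
  have a1 := hu.2.2.2 _ hv.1
  have a2 := hu.2.2.2 _ hv.2.1
  have a3 := hv.2.2.2 _ hu.1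
  have a4 := hv.2.2.2 _ hu.2.1
  ext <;> omega

section Congr

variable {d u : ℤ × ℤ} {c c' : ℤ} {k k' : (ℤ × ℤ) × (ℤ × ℤ)}

theorem sideForm_sign (hu : u ∈ E.cells d) (hc : u.1 ≤ c ∧ c < u.2) (hc' : u.1 ≤ c' ∧ c' < u.2)
    (hk : E.IsLine d k) {s : MirrorSegment} (hs : s ∈ E.segments) :
    (sideForm d k s.a s.b c).sign = (sideForm d k s.a s.b c').sign := by
  obtain ⟨o, ho, rfl⟩ := hk
  rw [sideForm_eq, sideForm_eq _ _ _ _ c']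
  refine sign_eq_of_rootBreaks (fun b hb => (mem_cells.1 hu).2.2.2 b ?_) hc.1 hc.2 hc'.1 hc'.2
  refine List.mem_append_right _ (List.mem_flatMap.2 ⟨o, ho, List.mem_append_left _ ?_⟩)
  exact List.mem_flatMap.2 ⟨s, hs, hb⟩

theorem fstForm_sign (hu : u ∈ E.cells d) (hc : u.1 ≤ c ∧ c < u.2) (hc' : u.1 ≤ c' ∧ c' < u.2)
    (hk : E.IsLine d k) {e : ℤ × ℤ} (he : e ∈ E.points) :
    (fstForm d k e c).sign = (fstForm d k e c').sign := by
  obtain ⟨o, ho, rfl⟩ := hk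
  rw [fstForm_eq, fstForm_eq _ _ _ c']
  refine sign_eq_of_rootBreaks (fun b hb => (mem_cells.1 hu).2.2.2 b ?_) hc.1 hc.2 hc'.1 hc'.2
  refine List.mem_append_right _ (List.mem_flatMap.2 ⟨o, ho, List.mem_append_right _
    (List.mem_append_left _ ?_)⟩)
  exact List.mem_flatMap.2 ⟨e, he, List.mem_append_left _ hb⟩

theorem sndForm_sign (hu : u ∈ E.cells d) (hc : u.1 ≤ c ∧ c < u.2) (hc' : u.1 ≤ c' ∧ c' < u.2)
    (hk : E.IsLine d k) {e : ℤ × ℤ} (he : e ∈ E.points) :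
    (sndForm d k e c).sign = (sndForm d k e c').sign := by
  obtain ⟨o, ho, rfl⟩ := hk
  rw [sndForm_eq, sndForm_eq _ _ _ c']
  refine sign_eq_of_rootBreaks (fun b hb => (mem_cells.1 hu).2.2.2 b ?_) hc.1 hc.2 hc'.1 hc'.2
  refine List.mem_append_right _ (List.mem_flatMap.2 ⟨o, ho, List.mem_append_right _
    (List.mem_append_left _ ?_)⟩)
  exact List.mem_flatMap.2 ⟨e, he, List.mem_append_right _ hb⟩

theorem timeForm_congr (hu : u ∈ E.cells d) (hc : u.1 ≤ c ∧ c < u.2) (hc' : u.1 ≤ c' ∧ c' < u.2)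
    (hk : E.IsLine d k) (hk' : E.IsLine d k') : 0 < timeForm d k k' c ↔ 0 < timeForm d k k' c' := by
  obtain ⟨o, ho, rfl⟩ := hk
  obtain ⟨o', ho', rfl⟩ := hk'
  rw [timeForm_eq, timeForm_eq _ _ _ c']
  refine pos_congr (sign_eq_of_rootBreaks (fun b hb => (mem_cells.1 hu).2.2.2 b ?_) hc.1 hc.2
    hc'.1 hc'.2)
  refine List.mem_append_right _ (List.mem_flatMap.2 ⟨o, ho, List.mem_append_right _
    (List.mem_append_right _ ?_)⟩)
  exact List.mem_flatMap.2 ⟨o', ho', hb⟩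

theorem crossesAt_congr_seg (hu : u ∈ E.cells d) (hc : u.1 ≤ c ∧ c < u.2)
    (hc' : u.1 ≤ c' ∧ c' < u.2) (hk : E.IsLine d k) {s : MirrorSegment} (hs : s ∈ E.segments) :
    CrossesAt d k s.a s.b c ↔ CrossesAt d k s.a s.b c' := by
  have ha := mem_points_of_mem_endpoints (a_mem_endpoints hs)
  have hb := mem_points_of_mem_endpoints (b_mem_endpoints hs)
  exact and_congr (eq_zero_congr (sideForm_sign hu hc hc' hk hs)) (and_congr
    (mul_nonpos_congr (fstForm_sign hu hc hc' hk ha) (fstForm_sign hu hc hc' hk hb))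
    (mul_nonpos_congr (sndForm_sign hu hc hc' hk ha) (sndForm_sign hu hc hc' hk hb)))

theorem crossesAt_congr_point (hu : u ∈ E.cells d) (hc : u.1 ≤ c ∧ c < u.2)
    (hc' : u.1 ≤ c' ∧ c' < u.2) (hk : E.IsLine d k) {e : ℤ × ℤ} (he : e ∈ E.points) :
    CrossesAt d k e e c ↔ CrossesAt d k e e c' := by
  unfold CrossesAt
  rw [sideForm_self, sideForm_self]
  exact and_congr Iff.rfl (and_congr
    (mul_nonpos_congr (fstForm_sign hu hc hc' hk he) (fstForm_sign hu hc hc' hk he))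
    (mul_nonpos_congr (sndForm_sign hu hc hc' hk he) (sndForm_sign hu hc hc' hk he)))

theorem crossesAt_congr_obstacle (hu : u ∈ E.cells d) (hc : u.1 ≤ c ∧ c < u.2)
    (hc' : u.1 ≤ c' ∧ c' < u.2) {o : ((ℤ × ℤ) × (ℤ × ℤ)) × (ℤ × ℤ)} (ho : o ∈ E.obstacles d) :
    CrossesAt d o.1 o.1.1 o.2 c ↔ CrossesAt d o.1 o.1.1 o.2 c' := by
  have hk : E.IsLine d o.1 := ⟨o, ho, rfl⟩
  rcases mem_obstacles.1 ho with ⟨s, hs, -, rfl⟩ | ⟨e, he, rfl⟩ | ⟨-, rfl⟩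
  · exact crossesAt_congr_seg hu hc hc' hk hs
  · exact crossesAt_congr_point hu hc hc' hk (mem_points_of_mem_endpoints he)
  · exact crossesAt_congr_point hu hc hc' hk start_mem_points

theorem clean_congr (hu : u ∈ E.cells d) (hc : u.1 ≤ c ∧ c < u.2) (hc' : u.1 ≤ c' ∧ c' < u.2)
    {s : MirrorSegment} (hs : s ∈ E.segments) : E.Clean s d c ↔ E.Clean s d c' := by
  refine and_congr_right fun h => ?_
  have hk := isLine_line hs h
  refine and_congr (crossesAt_congr_seg hu hc hc' hk hs) (and_congr ?_ ?_)
  · exact forall₂_congr fun e he => not_congr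
      (crossesAt_congr_point hu hc hc' hk (mem_points_of_mem_endpoints he))
  · exact forall₂_congr fun s' hs' => imp_congr_right fun _ => not_congr
      (crossesAt_congr_seg hu hc hc' hk hs')

theorem starts_congr (hu : u ∈ E.cells d) (hc : u.1 ≤ c ∧ c < u.2) (hc' : u.1 ≤ c' ∧ c' < u.2)
    {s : MirrorSegment} (hs : s ∈ E.segments) : E.Starts s d c ↔ E.Starts s d c' := by
  unfold Starts
  by_cases h : cross s.vec d = 0
  · simp [Clean, h]
  rw [clean_congr hu hc hc' hs,
    crossesAt_congr_point hu hc hc' (isLine_line hs h) start_mem_points]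

/-- One test per beam therefore decides the first reflection of all its rays. The source line only
has to carry some obstacle, which provides the breaks for the time comparisons. -/
theorem hits_congr (hu : u ∈ E.cells d) (hc : u.1 ≤ c ∧ c < u.2) (hc' : u.1 ≤ c' ∧ c' < u.2)
    {s s' : MirrorSegment} (hs : E.IsLine d s.line) (hs' : s' ∈ E.segments) :
    E.Hits s d c s' ↔ E.Hits s d c' s' := by
  unfold Hits
  by_cases h : cross s'.vec d = 0
  · simp [Clean, h]
  have hk := isLine_line hs' h
  refine and_congr (clean_congr hu hc hc' hs') (and_congr (timeForm_congr hu hc hc' hs hk)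
    (and_congr (forall₂_congr fun o ho => not_congr ?_) (and_congr_right fun _ => not_congr
      (and_congr_left fun _ => crossesAt_congr_point hu hc hc' hk start_mem_points))))
  have ho' : E.IsLine d o.1 := ⟨o, ho, rfl⟩
  exact and_congr (crossesAt_congr_obstacle hu hc hc' ho) (and_congr
    (timeForm_congr hu hc hc' hs ho') (timeForm_congr hu hc hc' ho' hk))

end Congr

end Environment

/-! ### Coordinates along and across a direction -/

/-- The coordinate of a point across the direction `d`. -/
def crossCoord (d : ℤ × ℤ) (q : ℝ × ℝ) : ℝ := d.1 * q.2 - d.2 * q.1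

/-- The coordinate of a point along the direction `d`. -/
def dotCoord (d : ℤ × ℤ) (q : ℝ × ℝ) : ℝ := d.1 * q.1 + d.2 * q.2

/-- The point where the line `k` meets the line in direction `d` at position `c`. -/
noncomputable def crossPoint (d : ℤ × ℤ) (k : (ℤ × ℤ) × (ℤ × ℤ)) (c : ℤ) : ℝ × ℝ :=
  (((crossNum d k c).1 : ℝ) / crossDen d k, ((crossNum d k c).2 : ℝ) / crossDen d k)

theorem normSq_pos {d : ℤ × ℤ} (hd : d ≠ 0) : (0 : ℝ) < (d.1 : ℝ) * d.1 + (d.2 : ℝ) * d.2 := by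
  have h : d.1 ≠ 0 ∨ d.2 ≠ 0 := by
    by_contra! h
    exact hd (Prod.ext h.1 h.2)
  rcases h with h | h
  · have : (0 : ℝ) < (d.1 : ℝ) * d.1 := mul_self_pos.2 (by exact_mod_cast h)
    nlinarith [mul_self_nonneg (d.2 : ℝ)]
  · have : (0 : ℝ) < (d.2 : ℝ) * d.2 := mul_self_pos.2 (by exact_mod_cast h)
    nlinarith [mul_self_nonneg (d.1 : ℝ)]

theorem eq_of_coord_eq {d : ℤ × ℤ} (hd : d ≠ 0) {p q : ℝ × ℝ}
    (h1 : crossCoord d p = crossCoord d q) (h2 : dotCoord d p = dotCoord d q) : p = q := by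
  have h := normSq_pos hd
  unfold crossCoord at h1
  unfold dotCoord at h2
  refine Prod.ext (mul_left_cancel₀ h.ne' ?_) (mul_left_cancel₀ h.ne' ?_)
  · linear_combination (d.1 : ℝ) * h2 - (d.2 : ℝ) * h1
  · linear_combination (d.2 : ℝ) * h2 + (d.1 : ℝ) * h1

/-- Collinearity and betweenness in each coordinate are sign conditions that can be tested on
integers. Conversely, the parameter of the point is read off from a coordinate in which the
endpoints differ; `p = q` is allowed, so points are treated as segments. -/
theorem mem_segment_iff (p q x : ℝ × ℝ) : x ∈ segment ℝ p q ↔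
    (q.1 - p.1) * (x.2 - p.2) - (q.2 - p.2) * (x.1 - p.1) = 0 ∧
      (x.1 - p.1) * (x.1 - q.1) ≤ 0 ∧ (x.2 - p.2) * (x.2 - q.2) ≤ 0 := by
  rw [segment_eq_image']
  constructor
  · rintro ⟨t, ⟨h0, h1⟩, rfl⟩
    have h2 : 0 ≤ t * (1 - t) := mul_nonneg h0 (by linarith)
    refine ⟨?_, ?_, ?_⟩ <;> simp only [Prod.fst_add, Prod.snd_add, Prod.smul_fst, Prod.smul_snd,
      Prod.fst_sub, Prod.snd_sub, smul_eq_mul]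
    · ring
    · nlinarith [mul_nonneg h2 (mul_self_nonneg (q.1 - p.1))]
    · nlinarith [mul_nonneg h2 (mul_self_nonneg (q.2 - p.2))]
  · rintro ⟨h0, h1, h2⟩
    have key : ∀ u v y : ℝ, v ≠ u → (y - u) * (y - v) ≤ 0 →
        (y - u) / (v - u) ∈ Set.Icc (0 : ℝ) 1 := by
      intro u v y huv h
      have hne : v - u ≠ 0 := sub_ne_zero.2 huv
      have hsq : 0 < (v - u) * (v - u) := mul_self_pos.2 hne
      have e : (y - u) * (y - v) =
          (v - u) * (v - u) * ((y - u) / (v - u) * ((y - u) / (v - u) - 1)) := by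
        field_simp; ring
      rw [e] at h
      have h' := nonpos_of_mul_nonpos_right h hsq
      constructor <;> nlinarith
    by_cases e1 : q.1 = p.1
    · have x1 : x.1 = p.1 := by
        rw [e1] at h1
        nlinarith [mul_self_eq_zero.1 (le_antisymm h1 (mul_self_nonneg (x.1 - p.1)))]
      by_cases e2 : q.2 = p.2
      · have x2 : x.2 = p.2 := by
          rw [e2] at h2
          nlinarith [mul_self_eq_zero.1 (le_antisymm h2 (mul_self_nonneg (x.2 - p.2)))]
        exact ⟨0, by simp, by simpa using (Prod.ext x1 x2).symm⟩
      · refine ⟨_, key _ _ _ e2 h2, ?_⟩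
        have hne := sub_ne_zero.2 e2
        refine Prod.ext ?_ ?_ <;> simp only [Prod.fst_add, Prod.snd_add, Prod.smul_fst,
          Prod.smul_snd, Prod.fst_sub, Prod.snd_sub, smul_eq_mul]
        · rw [e1, x1]; ring
        · field_simp; ring
    · refine ⟨_, key _ _ _ e1 h1, ?_⟩
      have hne := sub_ne_zero.2 e1
      refine Prod.ext ?_ ?_ <;> simp only [Prod.fst_add, Prod.snd_add, Prod.smul_fst,
        Prod.smul_snd, Prod.fst_sub, Prod.snd_sub, smul_eq_mul]
      · field_simp; ring
      · field_simp; linarith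

theorem crossCoord_toPlane (d e : ℤ × ℤ) : crossCoord d (toPlane e) = (cross d e : ℤ) := by
  simp [crossCoord, toPlane, cross]

theorem cross_comm (u v : ℤ × ℤ) : cross u v = -cross v u := by
  unfold cross; ring

section CrossPoint

variable {d : ℤ × ℤ} {k k' : (ℤ × ℤ) × (ℤ × ℤ)} {c : ℤ}

theorem crossDen_pos (hk : cross d k.2 ≠ 0) : 0 < crossDen d k := mul_self_pos.2 hk

theorem crossPoint_eq (hk : cross d k.2 ≠ 0) :
    crossPoint d k c =
      (k.1.1 + ((c : ℝ) - (cross d k.1 : ℤ)) / (cross d k.2 : ℤ) * k.2.1,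
        k.1.2 + ((c : ℝ) - (cross d k.1 : ℤ)) / (cross d k.2 : ℤ) * k.2.2) := by
  have : ((cross d k.2 : ℤ) : ℝ) ≠ 0 := by exact_mod_cast hk
  refine Prod.ext ?_ ?_ <;> simp only [crossPoint, crossNum, crossDen] <;> push_cast <;>
    field_simp

theorem crossCoord_crossPoint (hk : cross d k.2 ≠ 0) : crossCoord d (crossPoint d k c) = c := by
  have h : ((cross d k.2 : ℤ) : ℝ) ≠ 0 := by exact_mod_cast hk
  rw [crossPoint_eq hk]
  simp only [crossCoord]
  field_simp
  simp only [cross] at *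
  push_cast at *
  ring

/-- A point on the line `k` is determined by its coordinate across `d`. -/
theorem eq_crossPoint (hk : cross d k.2 ≠ 0) {q : ℝ × ℝ} (h1 : crossCoord d q = c)
    (h2 : (k.2.1 : ℝ) * (q.2 - k.1.2) - k.2.2 * (q.1 - k.1.1) = 0) : q = crossPoint d k c := by
  have h : ((cross d k.2 : ℤ) : ℝ) ≠ 0 := by exact_mod_cast hk
  rw [crossPoint_eq hk]
  simp only [crossCoord] at h1
  have e : ((cross d k.2 : ℤ) : ℝ) = d.1 * k.2.2 - d.2 * k.2.1 := by simp [cross]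
  have e' : ((cross d k.1 : ℤ) : ℝ) = d.1 * k.1.2 - d.2 * k.1.1 := by simp [cross]
  refine Prod.ext ?_ ?_ <;> simp only <;> refine mul_left_cancel₀ h ?_ <;> field_simp <;>
    rw [e, e']
  · linear_combination (k.2.1 : ℝ) * h1 - (d.1 : ℝ) * h2
  · linear_combination (k.2.2 : ℝ) * h1 - (d.2 : ℝ) * h2

theorem line_crossPoint (hk : cross d k.2 ≠ 0) :
    (k.2.1 : ℝ) * ((crossPoint d k c).2 - k.1.2) - k.2.2 * ((crossPoint d k c).1 - k.1.1) = 0 := by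
  rw [crossPoint_eq hk]
  ring

/-- The integer forms are the real expressions of `mem_segment_iff` multiplied by the positive
denominator. -/
theorem crossesAt_iff (hk : cross d k.2 ≠ 0) (p q : ℤ × ℤ) :
    CrossesAt d k p q c ↔ crossPoint d k c ∈ segment ℝ (toPlane p) (toPlane q) := by
  have hZ : (0 : ℝ) < (crossDen d k : ℤ) := by exact_mod_cast crossDen_pos hk
  rw [mem_segment_iff]
  have e1 : ∀ e : ℤ × ℤ, ((fstForm d k e c : ℤ) : ℝ) =
      (crossDen d k : ℤ) * ((crossPoint d k c).1 - (toPlane e).1) := by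
    intro e
    simp only [fstForm, crossPoint, toPlane]
    push_cast
    field_simp
  have e2 : ∀ e : ℤ × ℤ, ((sndForm d k e c : ℤ) : ℝ) =
      (crossDen d k : ℤ) * ((crossPoint d k c).2 - (toPlane e).2) := by
    intro e
    simp only [sndForm, crossPoint, toPlane]
    push_cast
    field_simp
  have e3 : sideForm d k p q c =
      (q.1 - p.1) * sndForm d k p c - (q.2 - p.2) * fstForm d k p c := rfl
  have e4 : ((sideForm d k p q c : ℤ) : ℝ) = (crossDen d k : ℤ) *
      (((toPlane q).1 - (toPlane p).1) * ((crossPoint d k c).2 - (toPlane p).2) -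
        ((toPlane q).2 - (toPlane p).2) * ((crossPoint d k c).1 - (toPlane p).1)) := by
    rw [e3]
    push_cast
    rw [e1, e2]
    simp only [toPlane]
    ring
  have h0 : ∀ z : ℝ, (crossDen d k : ℤ) * z = 0 ↔ z = 0 := fun z => by simp [hZ.ne']
  have h1 : ∀ y z : ℝ, (crossDen d k : ℤ) * y * ((crossDen d k : ℤ) * z) ≤ 0 ↔ y * z ≤ 0 := by
    intro y z
    have : ((crossDen d k : ℤ) : ℝ) * y * ((crossDen d k : ℤ) * z) =
      ((crossDen d k : ℤ) : ℝ) * (crossDen d k : ℤ) * (y * z) := by ring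
    rw [this]
    exact mul_nonpos_iff_pos_imp_nonpos.trans ⟨fun h => h.1 (mul_pos hZ hZ), fun h =>
      ⟨fun _ => h, fun h' => (mul_pos hZ hZ).le⟩⟩
  unfold CrossesAt
  refine and_congr ?_ (and_congr ?_ ?_)
  · rw [← h0, ← e4]
    norm_cast
  · rw [← h1, ← e1, ← e1]
    norm_cast
  · rw [← h1, ← e2, ← e2]
    norm_cast

theorem crossesAt_self_iff (hk : cross d k.2 ≠ 0) (e : ℤ × ℤ) :
    CrossesAt d k e e c ↔ crossPoint d k c = toPlane e := by
  rw [crossesAt_iff hk, segment_same, Set.mem_singleton_iff]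

theorem timeForm_pos_iff (hk : cross d k.2 ≠ 0) (hk' : cross d k'.2 ≠ 0) :
    0 < timeForm d k k' c ↔ dotCoord d (crossPoint d k c) < dotCoord d (crossPoint d k' c) := by
  have hZ : (0 : ℝ) < (crossDen d k : ℤ) := by exact_mod_cast crossDen_pos hk
  have hZ' : (0 : ℝ) < (crossDen d k' : ℤ) := by exact_mod_cast crossDen_pos hk'
  have e : ((timeForm d k k' c : ℤ) : ℝ) = (crossDen d k : ℤ) * (crossDen d k' : ℤ) *
      (dotCoord d (crossPoint d k' c) - dotCoord d (crossPoint d k c)) := by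
    simp only [timeForm, dotCoord, crossPoint, dot]
    push_cast
    field_simp
  have h : (0 : ℝ) < (timeForm d k k' c : ℤ) ↔
      dotCoord d (crossPoint d k c) < dotCoord d (crossPoint d k' c) := by
    rw [e, mul_pos_iff_of_pos_left (mul_pos hZ hZ'), sub_pos]
  rw [← h]
  norm_cast

end CrossPoint

/-! ### Rays and obstacles -/

theorem crossCoord_point (r : Ray) (t : ℝ) :
    crossCoord r.dir (r.point t) = crossCoord r.dir r.pos := by
  simp only [crossCoord, Ray.point, toPlane, Prod.fst_add, Prod.snd_add, Prod.smul_mk, smul_eq_mul]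
  ring

theorem dotCoord_point (r : Ray) (t : ℝ) : dotCoord r.dir (r.point t) =
    dotCoord r.dir r.pos + t * ((r.dir.1 : ℝ) * r.dir.1 + (r.dir.2 : ℝ) * r.dir.2) := by
  simp only [dotCoord, Ray.point, toPlane, Prod.fst_add, Prod.snd_add, Prod.smul_mk, smul_eq_mul]
  ring

theorem cross_perp_ne_zero {d : ℤ × ℤ} (hd : d ≠ 0) : cross d (perp d) ≠ 0 := by
  have := normSq_pos hd
  have e : ((cross d (perp d) : ℤ) : ℝ) = (d.1 : ℝ) * d.1 + (d.2 : ℝ) * d.2 := by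
    simp [cross, perp]
  intro h
  rw [h] at e
  simp at e
  linarith

theorem crossPoint_perp {d : ℤ × ℤ} (hd : d ≠ 0) (e : ℤ × ℤ) :
    crossPoint d (e, perp d) (cross d e) = toPlane e := by
  refine (eq_crossPoint (k := (e, perp d)) (cross_perp_ne_zero hd) (crossCoord_toPlane d e) ?_).symm
  simp [toPlane]

theorem mem_line {s : MirrorSegment} {q : ℝ × ℝ} (h : q ∈ s.points) :
    (s.line.2.1 : ℝ) * (q.2 - s.line.1.2) - s.line.2.2 * (q.1 - s.line.1.1) = 0 := by
  have := ((mem_segment_iff _ _ _).1 h).1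
  simpa [MirrorSegment.line, MirrorSegment.vec, toPlane] using this

namespace Environment

variable {E : Environment}

theorem obstacle_transverse {d : ℤ × ℤ} (hd : d ≠ 0) {o : ((ℤ × ℤ) × (ℤ × ℤ)) × (ℤ × ℤ)}
    (ho : o ∈ E.obstacles d) : cross d o.1.2 ≠ 0 := by
  rcases mem_obstacles.1 ho with ⟨s, -, hs, rfl⟩ | ⟨e, -, rfl⟩ | ⟨-, rfl⟩
  · rw [cross_comm]
    exact neg_ne_zero.2 hs
  · exact cross_perp_ne_zero hd
  · exact cross_perp_ne_zero hd

theorem isEndpoint_iff {q : ℝ × ℝ} : E.IsEndpoint q ↔ ∃ e ∈ E.endpoints, q = toPlane e := by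
  unfold IsEndpoint endpoints
  simp only [List.mem_flatMap]
  constructor
  · rintro ⟨s, hs, h | h⟩
    · exact ⟨s.a, ⟨s, hs, by simp⟩, h⟩
    · exact ⟨s.b, ⟨s, hs, by simp⟩, h⟩
  · rintro ⟨e, ⟨s, hs, he⟩, h⟩
    simp only [List.mem_cons, List.not_mem_nil, or_false] at he
    rcases he with rfl | rfl
    · exact ⟨s, hs, .inl h⟩
    · exact ⟨s, hs, .inr h⟩

theorem eq_crossPoint_of_mem {s : MirrorSegment} {d : ℤ × ℤ} {c : ℤ} {q : ℝ × ℝ}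
    (hq : crossCoord d q = c) (hs : cross s.vec d ≠ 0) (h : q ∈ s.points) :
    q = crossPoint d s.line c := by
  rw [cross_comm] at hs
  exact eq_crossPoint (k := s.line) (neg_ne_zero.1 hs) hq (mem_line h)

/-- Each obstacle is carried by a line transverse to the ray, hence offers only one candidate point.
Parallel segments matter only through their endpoints, which are carried by perpendiculars. -/
theorem meets_iff {r : Ray} (hd : r.dir ≠ 0) {c : ℤ} (hc : crossCoord r.dir r.pos = c) (t : ℝ) :
    E.Meets r t ↔ ∃ o ∈ E.obstacles r.dir, CrossesAt r.dir o.1 o.1.1 o.2 c ∧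
      r.point t = crossPoint r.dir o.1 c := by
  have hq : crossCoord r.dir (r.point t) = c := (crossCoord_point r t).trans hc
  have hpt : ∀ e, r.point t = toPlane e → CrossesAt r.dir (e, perp r.dir) e e c ∧
      r.point t = crossPoint r.dir (e, perp r.dir) c := by
    intro e he
    have : cross r.dir e = c := by
      rw [he, crossCoord_toPlane] at hq
      exact_mod_cast hq
    rw [crossesAt_self_iff (cross_perp_ne_zero hd), ← this, crossPoint_perp hd]
    exact ⟨rfl, he⟩
  constructor
  · rintro (⟨s, hs, hns, h⟩ | h | ⟨h, hdir⟩)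
    · have he := eq_crossPoint_of_mem hq hns h
      refine ⟨_, mem_obstacles.2 (.inl ⟨s, hs, hns, rfl⟩), ?_, he⟩
      rw [cross_comm] at hns
      rw [crossesAt_iff (k := s.line) (neg_ne_zero.1 hns), ← he]
      exact h
    · obtain ⟨e, he, h⟩ := isEndpoint_iff.1 h
      exact ⟨_, mem_obstacles.2 (.inr (.inl ⟨e, he, rfl⟩)), hpt e h⟩
    · exact ⟨_, mem_obstacles.2 (.inr (.inr ⟨hdir, rfl⟩)), hpt _ h⟩
  · rintro ⟨o, ho, h1, h2⟩
    rw [crossesAt_iff (obstacle_transverse hd ho), ← h2] at h1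
    rcases mem_obstacles.1 ho with ⟨s, hs, hns, rfl⟩ | ⟨e, he, rfl⟩ | ⟨hdir, rfl⟩
    · exact .inl ⟨s, hs, hns, h1⟩
    · exact .inr (.inl (isEndpoint_iff.2 ⟨e, he, by simpa using h1⟩))
    · exact .inr (.inr ⟨by simpa using h1, hdir⟩)

/-- The ray and the crossing point agree across the direction, so only the coordinate along it
remains. Comparing meeting times thus becomes comparing these coordinates, as `timeForm` does. -/
theorem point_eq_crossPoint_iff {r : Ray} (hd : r.dir ≠ 0) {c : ℤ}
    (hc : crossCoord r.dir r.pos = c) {k : (ℤ × ℤ) × (ℤ × ℤ)} (hk : cross r.dir k.2 ≠ 0) (t : ℝ) :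
    r.point t = crossPoint r.dir k c ↔
      t = (dotCoord r.dir (crossPoint r.dir k c) - dotCoord r.dir r.pos) /
        ((r.dir.1 : ℝ) * r.dir.1 + (r.dir.2 : ℝ) * r.dir.2) := by
  have hN := normSq_pos hd
  rw [eq_div_iff hN.ne']
  have h := dotCoord_point r t
  constructor
  · intro e
    rw [e] at h
    linarith
  · intro e
    refine eq_of_coord_eq hd ?_ (by linarith)
    rw [crossCoord_point, hc, crossCoord_crossPoint hk]

/-- The ray is first reflected at a point of the segment. -/
def ReflectedAt (E : Environment) (r : Ray) (s : MirrorSegment) : Prop :=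
  ∃ t, E.FirstMeets r t ∧ ¬ E.StopsAt r t ∧ r.point t ∈ s.points

/-- Each obstacle allows at most one meeting time, so there are finitely many, and a least one if
there are any. -/
theorem escapes_or_absorbed_or_reflectedAt {r : Ray} (hd : r.dir ≠ 0) {c : ℤ}
    (hc : crossCoord r.dir r.pos = c) :
    E.Absorbed r ∨ E.Escapes r ∨ ∃ s ∈ E.segments, E.ReflectedAt r s := by
  have hfin : {t | 0 < t ∧ E.Meets r t}.Finite := by
    refine ((E.obstacles r.dir).toFinset.finite_toSet.image fun o =>
      (dotCoord r.dir (crossPoint r.dir o.1 c) - dotCoord r.dir r.pos) /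
        ((r.dir.1 : ℝ) * r.dir.1 + (r.dir.2 : ℝ) * r.dir.2)).subset ?_
    rintro t ⟨-, ht⟩
    obtain ⟨o, ho, -, h⟩ := (meets_iff hd hc t).1 ht
    exact ⟨o, by simpa using ho,
      ((point_eq_crossPoint_iff hd hc (obstacle_transverse hd ho) t).1 h).symm⟩
  by_cases hne : {t | 0 < t ∧ E.Meets r t}.Nonempty
  · obtain ⟨t, ht, hmin⟩ := Set.exists_min_image _ id hfin hne
    have hfirst : E.FirstMeets r t := ⟨ht.1, ht.2, fun t' h0 hlt hm =>
      absurd (hmin t' ⟨h0, hm⟩) (not_le.2 hlt)⟩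
    by_cases hs : E.StopsAt r t
    · exact .inl ⟨t, hfirst, hs⟩
    · rcases ht.2 with ⟨s, hs', -, h⟩ | h | ⟨h1, h2⟩
      · exact .inr (.inr ⟨s, hs', t, hfirst, hs, h⟩)
      · exact absurd (.inl h) hs
      · exact absurd (.inr (.inr (.inr ⟨h1, .inl h2⟩))) hs
  · refine .inr (.inl fun t ht hm => hne ⟨t, ht, hm⟩)

theorem not_both_of_clean {s s' : MirrorSegment} {d : ℤ × ℤ} {c : ℤ} (h : E.Clean s d c)
    (hs' : s' ∈ E.segments) (hm : crossPoint d s.line c ∈ s'.points) : s' = s := by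
  have hk : cross d s.line.2 ≠ 0 := by
    have := h.1
    rw [cross_comm] at this
    exact neg_ne_zero.1 this
  by_contra hne
  exact h.2.2.2 s' hs' hne ((crossesAt_iff hk _ _).2 hm)

end Environment

/-! ### Reflection of directions and positions -/

theorem mirrorImage_iff {s : MirrorSegment} (hs : s.Octilinear) (d d' : ℤ × ℤ) :
    s.MirrorImage d d' ↔ d' = mirror s.vec d := by
  obtain ⟨hne, hoct⟩ := hs
  have h0 : s.vec ≠ 0 := fun h => hne (sub_eq_zero.1 h).symm
  unfold MirrorSegment.MirrorImage
  generalize s.vec = w at *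
  obtain ⟨w1, w2⟩ := w
  obtain ⟨d1, d2⟩ := d
  obtain ⟨e1, e2⟩ := d'
  unfold mirror dot cross
  simp only [ne_eq, Prod.mk_eq_zero, not_and] at *
  split_ifs with h1 h2 h3
  · subst h1
    have : w1 ≠ 0 := fun h => h0 h rfl
    simp only [zero_mul, add_zero, sub_zero, Prod.mk.injEq]
    constructor
    · rintro ⟨h, h'⟩
      exact ⟨mul_left_cancel₀ this h, mul_left_cancel₀ this (by linarith)⟩
    · rintro ⟨rfl, rfl⟩
      exact ⟨rfl, by ring⟩
  · subst h2
    simp only [zero_mul, zero_add, zero_sub, Prod.mk.injEq]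
    constructor
    · rintro ⟨h, h'⟩
      exact ⟨mul_left_cancel₀ h1 (by linarith), mul_left_cancel₀ h1 h⟩
    · rintro ⟨rfl, rfl⟩
      exact ⟨rfl, by ring⟩
  · subst h3
    constructor
    · rintro ⟨h, h'⟩
      have a1 : e1 + e2 = d1 + d2 := mul_left_cancel₀ h1 (by linarith)
      have a2 : e2 - e1 = d1 - d2 := mul_left_cancel₀ h1 (by linarith)
      exact Prod.ext (by dsimp only; omega) (by dsimp only; omega)
    · intro h
      simp only [Prod.mk.injEq] at h
      obtain ⟨rfl, rfl⟩ := h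
      exact ⟨by ring, by ring⟩
  · have h4 : w1 = -w2 := by tauto
    subst h4
    constructor
    · rintro ⟨h, h'⟩
      have a1 : e2 - e1 = d2 - d1 := mul_left_cancel₀ h1 (by linarith)
      have a2 : e2 + e1 = -(d1 + d2) := mul_left_cancel₀ h1 (by linarith)
      exact Prod.ext (by dsimp only; omega) (by dsimp only; omega)
    · intro h
      simp only [Prod.mk.injEq] at h
      obtain ⟨rfl, rfl⟩ := h
      exact ⟨by ring, by ring⟩

theorem mirror_mirror (w d : ℤ × ℤ) : mirror w (mirror w d) = d := by
  unfold mirror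
  split_ifs <;> simp

namespace MirrorSegment

theorem line_transverse {s : MirrorSegment} {d : ℤ × ℤ} :
    cross d s.line.2 ≠ 0 ↔ cross s.vec d ≠ 0 := by
  rw [cross_comm d, neg_ne_zero]
  rfl

theorem ReflectsFrom.transverse {s : MirrorSegment} {d : ℤ × ℤ} (h : s.ReflectsFrom d) :
    cross s.vec d ≠ 0 := by
  rcases h with h | h
  · exact h.1.ne'
  · exact h.1.ne

/-- The position across the reflected direction, if a ray at position `c` across the direction `d`
is reflected. -/
def mirrorPos (s : MirrorSegment) (d : ℤ × ℤ) (c : ℤ) : ℤ :=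
  cross (mirror s.vec d) s.a + cross d s.a - c

theorem cross_mirror {s : MirrorSegment} (hs : s.Octilinear) (d : ℤ × ℤ) :
    cross s.vec (mirror s.vec d) = -cross s.vec d :=
  ((mirrorImage_iff hs d _).2 rfl).2

/-- Along the segment the positions across the two directions change at opposite rates, because the
cross product with its vector changes sign. Their sum is constant and can be evaluated at `s.a`. -/
theorem crossPoint_mirrorPos {s : MirrorSegment} (hs : s.Octilinear) {d : ℤ × ℤ}
    (hd : cross s.vec d ≠ 0) (c : ℤ) :
    crossPoint (mirror s.vec d) s.line (s.mirrorPos d c) = crossPoint d s.line c := by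
  have hm := cross_mirror hs d
  have hk : cross d s.line.2 ≠ 0 := line_transverse.2 hd
  have hk' : cross (mirror s.vec d) s.line.2 ≠ 0 := line_transverse.2 (by rw [hm]; simpa using hd)
  refine (eq_crossPoint hk' ?_ (line_crossPoint hk)).symm
  have h : ((cross d s.line.2 : ℤ) : ℝ) ≠ 0 := by exact_mod_cast hk
  have e : ((cross (mirror s.vec d) s.line.2 : ℤ) : ℝ) = -(cross d s.line.2 : ℤ) := by
    rw [cross_comm _ s.line.2, cross_comm d s.line.2]
    change ((-cross s.vec (mirror s.vec d) : ℤ) : ℝ) = -((-cross s.vec d : ℤ) : ℝ)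
    rw [hm]
    push_cast
    ring
  have e1 : ((s.mirrorPos d c : ℤ) : ℝ) =
      (cross (mirror s.vec d) s.line.1 : ℤ) + (cross d s.line.1 : ℤ) - c := by
    simp [mirrorPos, line]
  rw [e1, crossPoint_eq hk]
  have e2 : ∀ x : ℝ, crossCoord (mirror s.vec d) ((s.line.1.1 : ℝ) + x * s.line.2.1,
      (s.line.1.2 : ℝ) + x * s.line.2.2) = (cross (mirror s.vec d) s.line.1 : ℤ) +
        x * (cross (mirror s.vec d) s.line.2 : ℤ) := by
    intro x
    simp only [crossCoord, cross]
    push_cast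
    ring
  rw [e2, e]
  field_simp
  ring

end MirrorSegment

theorem mirror_mem_directions {E : Environment} (w : ℤ × ℤ) {d : ℤ × ℤ} (hd : d ∈ E.directions) :
    mirror w d ∈ E.directions := by
  unfold Environment.directions at *
  unfold mirror
  simp only [List.mem_cons, List.not_mem_nil, or_false] at *
  split_ifs <;> rcases hd with rfl | rfl | rfl | rfl | rfl | rfl | rfl | rfl <;> simp

namespace Environment

variable {E : Environment}

theorem ne_zero_of_mem_directions (hE : E.Valid) {d : ℤ × ℤ} (hd : d ∈ E.directions) : d ≠ 0 := by
  rintro rfl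
  have h := hE.2
  unfold directions at hd
  simp only [List.mem_cons, List.not_mem_nil, or_false, Prod.zero_eq_mk, Prod.mk.injEq] at hd
  refine h (Prod.ext ?_ ?_) <;> simp only [Prod.fst_zero, Prod.snd_zero] <;> omega

theorem dir_mem_directions : E.dir ∈ E.directions := by simp [directions]

theorem reflectsFrom_of_not_stopsAt {r : Ray} {t : ℝ} (h : ¬ E.StopsAt r t) {s : MirrorSegment}
    (hs : s ∈ E.segments) (hm : r.point t ∈ s.points) : s.ReflectsFrom r.dir := by
  by_contra hr
  exact h (.inr (.inr (.inl ⟨s, hs, hm, hr⟩)))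

/-- The bridge from integer tests to geometry. Cleanness makes `s'` the only segment through the hit
point, so all clauses of `StopsAt` become conditions on `s'`. The carrier `s` need not belong to the
environment, which admits the initial beam. -/
theorem hits_iff (hE : E.Valid) {s s' : MirrorSegment} {d : ℤ × ℤ} (hd : d ≠ 0) (c : ℤ) (o : Bool)
    (hs : cross s.vec d ≠ 0) (hs' : s' ∈ E.segments) :
    E.Hits s d c s' ↔ E.ReflectedAt ⟨crossPoint d s.line c, d, o⟩ s' := by
  have hk : cross d s.line.2 ≠ 0 := MirrorSegment.line_transverse.2 hs
  have hc : crossCoord d (crossPoint d s.line c) = c := crossCoord_crossPoint hk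
  have hN := normSq_pos hd
  set r : Ray := ⟨crossPoint d s.line c, d, o⟩ with hr
  have hmeets := fun t => meets_iff (E := E) (r := r) hd hc t
  have hpoint := fun {k : (ℤ × ℤ) × (ℤ × ℤ)} (h : cross d k.2 ≠ 0) t =>
    point_eq_crossPoint_iff (r := r) hd hc h t
  constructor
  · rintro ⟨hclean, htime, hobs, hrefl, hstart⟩
    have hk' : cross d s'.line.2 ≠ 0 := MirrorSegment.line_transverse.2 hclean.1
    rw [timeForm_pos_iff hk hk'] at htime
    set t := (dotCoord d (crossPoint d s'.line c) - dotCoord d (crossPoint d s.line c)) /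
        ((d.1 : ℝ) * d.1 + (d.2 : ℝ) * d.2) with ht
    have hq : r.point t = crossPoint d s'.line c := (hpoint hk' t).2 ht
    have hmem : r.point t ∈ s'.points := by
      rw [hq]
      exact (crossesAt_iff hk' _ _).1 hclean.2.1
    have huniq : ∀ s'' ∈ E.segments, r.point t ∈ s''.points → s'' = s' := fun s'' h'' hm =>
      not_both_of_clean hclean h'' (by rwa [← hq])
    refine ⟨t, ⟨div_pos (sub_pos.2 htime) hN, .inl ⟨s', hs', hclean.1, hmem⟩, ?_⟩, ?_, hmem⟩
    · intro t' h0 hlt hm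
      obtain ⟨b, hb, hb1, hb2⟩ := (hmeets t').1 hm
      have hbk := obstacle_transverse hd hb
      have hb3 := (hpoint hbk t').1 hb2
      refine hobs b hb ⟨hb1, (timeForm_pos_iff hk hbk).2 ?_, (timeForm_pos_iff hbk hk').2 ?_⟩
      · rw [hb3, div_pos_iff_of_pos_right hN] at h0
        exact sub_pos.1 h0
      · rw [hb3, ht, div_lt_div_iff_of_pos_right hN] at hlt
        exact sub_lt_sub_iff_right _ |>.1 hlt
    · rintro (h | ⟨s1, h1, s2, h2, hne, m1, m2⟩ | ⟨s1, h1, m1, hn⟩ | ⟨h, h'⟩)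
      · obtain ⟨e, he, h⟩ := isEndpoint_iff.1 h
        rw [hq] at h
        exact hclean.2.2.1 e he ((crossesAt_self_iff hk' e).2 h)
      · exact hne ((huniq s1 h1 m1).trans (huniq s2 h2 m2).symm)
      · rw [huniq s1 h1 m1] at hn
        exact hn hrefl
      · rw [hq] at h
        refine hstart ⟨(crossesAt_self_iff hk' _).2 h, h'.imp_right ?_⟩
        rintro ⟨s1, h1, m1, hi⟩
        rw [huniq s1 h1 m1] at hi
        exact ((mirrorImage_iff (hE.1 s' hs') _ _).1 hi).symm
  · rintro ⟨t, ⟨h0, hm, hfirst⟩, hcont, hmem⟩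
    have hrefl : s'.ReflectsFrom d := reflectsFrom_of_not_stopsAt hcont hs' hmem
    have hn := hrefl.transverse
    have hk' : cross d s'.line.2 ≠ 0 := MirrorSegment.line_transverse.2 hn
    have hq : r.point t = crossPoint d s'.line c :=
      eq_crossPoint_of_mem (by rw [← hc]; exact crossCoord_point r t) hn hmem
    have ht := (hpoint hk' t).1 hq
    refine ⟨⟨hn, (crossesAt_iff hk' _ _).2 (by rw [← hq]; exact hmem), ?_, ?_⟩, ?_, ?_, hrefl, ?_⟩
    · intro e he h
      rw [crossesAt_self_iff hk', ← hq] at h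
      exact hcont (.inl (isEndpoint_iff.2 ⟨e, he, h⟩))
    · intro s'' h'' hne h
      rw [crossesAt_iff hk', ← hq] at h
      exact hcont (.inr (.inl ⟨s'', h'', s', hs', hne, h, hmem⟩))
    · rw [timeForm_pos_iff hk hk']
      rw [ht, div_pos_iff_of_pos_right hN] at h0
      exact sub_pos.1 h0
    · rintro b hb ⟨hb1, hb2, hb3⟩
      have hbk := obstacle_transverse hd hb
      rw [timeForm_pos_iff hk hbk] at hb2
      rw [timeForm_pos_iff hbk hk'] at hb3
      refine hfirst ((dotCoord d (crossPoint d b.1 c) - dotCoord d (crossPoint d s.line c)) /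
        ((d.1 : ℝ) * d.1 + (d.2 : ℝ) * d.2)) (div_pos (sub_pos.2 hb2) hN) ?_
        ((hmeets _).2 ⟨b, hb, hb1, (hpoint hbk _).2 rfl⟩)
      rw [ht, div_lt_div_iff_of_pos_right hN]
      exact sub_lt_sub_right hb3 _
    · rintro ⟨h1, h2⟩
      rw [crossesAt_self_iff hk', ← hq] at h1
      refine hcont (.inr (.inr (.inr ⟨h1, h2.imp_right fun h => ?_⟩)))
      exact ⟨s', hs', hmem, (mirrorImage_iff (hE.1 s' hs') _ _).2 h.symm⟩

theorem ReflectedAt.reflectsTo (hE : E.Valid) {r : Ray} {c : ℤ} (hc : crossCoord r.dir r.pos = c)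
    {s : MirrorSegment} (hs : s ∈ E.segments) (h : E.ReflectedAt r s) :
    E.ReflectsTo r ⟨crossPoint (mirror s.vec r.dir) s.line (s.mirrorPos r.dir c),
      mirror s.vec r.dir, !r.orient⟩ := by
  obtain ⟨t, h1, h2, h3⟩ := h
  have hn := (reflectsFrom_of_not_stopsAt h2 hs h3).transverse
  refine ⟨t, h1, h2, ?_, rfl, s, hs, h3, (mirrorImage_iff (hE.1 s hs) _ _).2 rfl⟩
  rw [MirrorSegment.crossPoint_mirrorPos (hE.1 s hs) hn]
  exact (eq_crossPoint_of_mem ((crossCoord_point r t).trans hc) hn h3).symm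

/-- Where a ray is reflected, the reflected ray may start. -/
theorem Hits.starts (hE : E.Valid) {s s' : MirrorSegment} {d : ℤ × ℤ} {c : ℤ}
    (hs' : s' ∈ E.segments) (h : E.Hits s d c s') :
    E.Starts s' (mirror s'.vec d) (s'.mirrorPos d c) := by
  obtain ⟨⟨hn, h1, h2, h3⟩, -, -, hrefl, hstart⟩ := h
  have hoct := hE.1 s' hs'
  have hm := MirrorSegment.cross_mirror hoct d
  have hn' : cross s'.vec (mirror s'.vec d) ≠ 0 := by rw [hm]; simpa using hn
  have e : ∀ p q, CrossesAt (mirror s'.vec d) s'.line p q (s'.mirrorPos d c) ↔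
      CrossesAt d s'.line p q c := by
    intro p q
    rw [crossesAt_iff (MirrorSegment.line_transverse.2 hn'),
      crossesAt_iff (MirrorSegment.line_transverse.2 hn),
      MirrorSegment.crossPoint_mirrorPos hoct hn]
  refine ⟨⟨hn', (e _ _).2 h1, fun p hp h => h2 p hp ((e _ _).1 h),
    fun s'' hs'' hne h => h3 s'' hs'' hne ((e _ _).1 h)⟩, ?_, ?_⟩
  · unfold MirrorSegment.Emits
    rw [hm]
    rcases hrefl with ⟨h, h'⟩ | ⟨h, h'⟩
    · exact .inr ⟨by omega, h'⟩
    · exact .inl ⟨by omega, h'⟩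
  -- Being reflected into the initial ray counts as absorption, which `Hits` excludes.
  · rintro ⟨h, h'⟩
    exact hstart ⟨(e _ _).1 h', .inr h⟩

end Environment

/-! ### Beams -/

namespace Beam

/-- The ray of the family at position `c`. -/
noncomputable def ray (B : Beam) (c : ℤ) : Ray := ⟨crossPoint B.dir B.seg.line c, B.dir, B.orient⟩

def Contains (B : Beam) (c : ℤ) : Prop := B.lo ≤ c ∧ c < B.hi

theorem sgn_mul_sgn (B : Beam) : B.sgn * B.sgn = 1 := by
  unfold sgn; split_ifs <;> rfl

theorem contains_iff (B : Beam) (i : ℤ) :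
    B.Contains (B.first + B.sgn * i) ↔ 0 ≤ i ∧ i < B.len := by
  unfold Contains first sgn len
  split_ifs <;> omega

end Beam

namespace Environment

variable {E : Environment}

theorem startBeam_line : E.startBeam.seg.line = (E.start, perp E.dir) := by
  refine Prod.ext rfl (Prod.ext ?_ ?_) <;>
    simp [startBeam, MirrorSegment.line, MirrorSegment.vec]

theorem mem_beams {B : Beam} : B ∈ E.beams ↔ B = E.startBeam ∨
    (B.seg ∈ E.segments ∧ B.dir ∈ E.directions ∧ (B.lo, B.hi) ∈ E.cells B.dir ∧
      E.Starts B.seg B.dir B.lo) := by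
  unfold beams
  rw [List.mem_cons, mem_dedup]
  refine or_congr Iff.rfl ?_
  simp only [List.mem_flatMap]
  constructor
  · rintro ⟨s, hs, d, hd, o, -, u, hu, h⟩
    split_ifs at h with h'
    · obtain rfl := List.mem_singleton.1 h
      exact ⟨hs, hd, hu, h'⟩
    · simp at h
  · rintro ⟨hs, hd, hu, h⟩
    refine ⟨_, hs, _, hd, B.orient, by cases B.orient <;> simp, _, hu, ?_⟩
    rw [if_pos h]
    exact List.mem_singleton_self _

/-- The carrier of the initial beam has no reflective side, whereas all other beams leave a
reflective side. -/
theorem nodup_beams : E.beams.Nodup := by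
  refine List.nodup_cons.2 ⟨fun h => ?_, nodup_dedup _⟩
  rw [mem_dedup] at h
  simp only [List.mem_flatMap] at h
  obtain ⟨s, -, d, -, o, -, u, -, h⟩ := h
  split_ifs at h with h'
  · obtain h := List.mem_singleton.1 h
    have hs : E.startBeam.seg = s := congrArg Beam.seg h
    rcases h'.2.1 with ⟨-, hl⟩ | ⟨-, hl⟩ <;> rw [← hs] at hl <;> simp [startBeam] at hl
  · simp at h

section Beams

variable {B C : Beam} {c : ℤ} {s : MirrorSegment}

theorem startBeam_transverse (hE : E.Valid) :
    cross E.startBeam.seg.vec E.startBeam.dir ≠ 0 := by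
  rw [← MirrorSegment.line_transverse, startBeam_line]
  exact cross_perp_ne_zero hE.2

theorem beam_dir (hB : B ∈ E.beams) : B.dir ∈ E.directions := by
  rcases mem_beams.1 hB with rfl | h
  · exact dir_mem_directions
  · exact h.2.1

theorem beam_transverse (hE : E.Valid) (hB : B ∈ E.beams) : cross B.seg.vec B.dir ≠ 0 := by
  rcases mem_beams.1 hB with rfl | h
  · exact startBeam_transverse hE
  · exact h.2.2.2.1.1

theorem beam_len_pos (hB : B ∈ E.beams) : 0 < B.len := by
  unfold Beam.len
  rcases mem_beams.1 hB with rfl | h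
  · simp [startBeam]
  · have := (mem_cells.1 h.2.2.1).2.2.1
    dsimp only at this
    omega

theorem startBeam_contains (h : E.startBeam.Contains c) : c = cross E.dir E.start := by
  unfold Beam.Contains startBeam at h
  dsimp only at h
  omega

theorem startBeam_ray (hE : E.Valid) : E.startBeam.ray (cross E.dir E.start) = E.startRay := by
  unfold Beam.ray
  rw [startBeam_line]
  have := crossPoint_perp hE.2 E.start
  simp only [startBeam, startRay, this]

theorem crossCoord_ray (hE : E.Valid) (hB : B ∈ E.beams) (c : ℤ) :
    crossCoord (B.ray c).dir (B.ray c).pos = c :=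
  crossCoord_crossPoint (MirrorSegment.line_transverse.2 (beam_transverse hE hB))

theorem starts_of_contains (hB : B ∈ E.beams) (h0 : B ≠ E.startBeam) (hc : B.Contains c) :
    B.seg ∈ E.segments ∧ E.Starts B.seg B.dir c := by
  rcases mem_beams.1 hB with rfl | h
  · exact absurd rfl h0
  · have hlo := (mem_cells.1 h.2.2.1).2.2.1
    exact ⟨h.1, (starts_congr h.2.2.1 ⟨le_rfl, hlo⟩ hc h.1).1 h.2.2.2⟩

/-- The segment of a beam is an obstacle on the way of its rays. -/
theorem exists_obstacle (hE : E.Valid) (hB : B ∈ E.beams) (hc : B.Contains c) :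
    ∃ o ∈ E.obstacles B.dir, o.1 = B.seg.line ∧ CrossesAt B.dir o.1 o.1.1 o.2 c := by
  by_cases h0 : B = E.startBeam
  · subst h0
    refine ⟨_, mem_obstacles.2 (.inr (.inr ⟨rfl, rfl⟩)), startBeam_line.symm, ?_⟩
    rw [startBeam_contains hc]
    exact (crossesAt_self_iff (cross_perp_ne_zero hE.2) _).2 (crossPoint_perp hE.2 _)
  · obtain ⟨hs, h⟩ := starts_of_contains hB h0 hc
    exact ⟨_, mem_obstacles.2 (.inl ⟨_, hs, h.1.1, rfl⟩), rfl, h.1.2.1⟩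

theorem hits_congr_of_contains (hE : E.Valid) (hB : B ∈ E.beams) (hc : B.Contains c)
    (hs : s ∈ E.segments) : E.Hits B.seg B.dir B.lo s ↔ E.Hits B.seg B.dir c s := by
  obtain ⟨o, ho, hl, -⟩ := exists_obstacle hE hB hc
  rcases mem_beams.1 hB with rfl | h
  · rw [startBeam_contains hc]
    rfl
  · have hlo := (mem_cells.1 h.2.2.1).2.2.1
    exact hits_congr h.2.2.1 ⟨le_rfl, hlo⟩ hc ⟨o, ho, hl⟩ hs

/-- Different beams have different rays. -/
theorem beam_eq_of_ray_eq (hE : E.Valid) (hB : B ∈ E.beams) (hC : C ∈ E.beams) {c c' : ℤ}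
    (hc : B.Contains c) (hc' : C.Contains c') (h : B.ray c = C.ray c') : B = C ∧ c = c' := by
  have hcc : c = c' := by
    have h1 := crossCoord_ray hE hB c
    have h2 := crossCoord_ray hE hC c'
    rw [h, h2] at h1
    exact_mod_cast h1.symm
  subst hcc
  refine ⟨?_, rfl⟩
  have hpos : crossPoint B.dir B.seg.line c = crossPoint C.dir C.seg.line c := congrArg Ray.pos h
  have hdir : B.dir = C.dir := congrArg Ray.dir h
  have hor : B.orient = C.orient := congrArg Ray.orient h
  -- `Starts` excludes the initial ray, so no other beam repeats it.
  have key : ∀ {A : Beam}, A ∈ E.beams → A.Contains c → A ≠ E.startBeam → A.dir = E.dir →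
      crossPoint A.dir A.seg.line c ≠ toPlane E.start := by
    intro A hA hAc h0 hd he
    obtain ⟨-, hst⟩ := starts_of_contains hA h0 hAc
    exact hst.2.2 ⟨hd, (crossesAt_self_iff
      (MirrorSegment.line_transverse.2 (beam_transverse hE hA)) _).2 he⟩
  have hstart : E.startBeam.Contains c →
      crossPoint E.startBeam.dir E.startBeam.seg.line c = toPlane E.start := by
    intro hc
    rw [startBeam_contains hc]
    exact congrArg Ray.pos (startBeam_ray hE)
  by_cases hB0 : B = E.startBeam
  · by_cases hC0 : C = E.startBeam
    · rw [hB0, hC0]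
    · subst hB0
      exact absurd (hpos.symm.trans (hstart hc)) (key hC hc' hC0 hdir.symm)
  · by_cases hC0 : C = E.startBeam
    · subst hC0
      exact absurd (hpos.trans (hstart hc')) (key hB hc hB0 hdir)
    · obtain ⟨hBs, hB1⟩ := starts_of_contains hB hB0 hc
      obtain ⟨hCs, hC1⟩ := starts_of_contains hC hC0 hc'
      have hseg : B.seg = C.seg := by
        refine not_both_of_clean hC1.1 hBs ?_
        rw [← hpos]
        exact (crossesAt_iff (MirrorSegment.line_transverse.2 hB1.1.1) _ _).1 hB1.1.2.1
      have hBu := (mem_beams.1 hB).resolve_left hB0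
      have hCu := (mem_beams.1 hC).resolve_left hC0
      have hcell := cell_unique (hdir ▸ hBu.2.2.1) hCu.2.2.1 hc.1 hc.2 hc'.1 hc'.2
      obtain ⟨s, d, o, lo, hi⟩ := B
      obtain ⟨s', d', o', lo', hi'⟩ := C
      rw [Prod.mk.injEq] at hcell
      rw [Beam.mk.injEq]
      exact ⟨hseg, hdir, hor, hcell⟩

/-- Rays of different beams are not reflected into the same ray. -/
theorem beam_eq_of_hits (hE : E.Valid) (hB : B ∈ E.beams) (hC : C ∈ E.beams)
    (hc : B.Contains c) (hc' : C.Contains c) (hdir : B.dir = C.dir) (hor : B.orient = C.orient)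
    (h : E.Hits B.seg B.dir c s) (h' : E.Hits C.seg C.dir c s) : B = C := by
  have hkB := MirrorSegment.line_transverse.2 (beam_transverse hE hB)
  have hkC := MirrorSegment.line_transverse.2 (beam_transverse hE hC)
  have hd := ne_zero_of_mem_directions hE (beam_dir hC)
  obtain ⟨oB, hoB, hlB, hcB⟩ := exists_obstacle hE hB hc
  obtain ⟨oC, hoC, hlC, hcC⟩ := exists_obstacle hE hC hc'
  rw [hdir] at h hkB hoB hcB
  -- Both rays run along the same line. If one starts behind the other, it meets the obstacle at the
  -- other's origin before reaching `s`, contrary to `Hits`.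
  rcases lt_trichotomy (dotCoord C.dir (crossPoint C.dir B.seg.line c))
    (dotCoord C.dir (crossPoint C.dir C.seg.line c)) with hlt | heq | hgt
  · refine absurd ⟨hcC, ?_, ?_⟩ (h.2.2.1 oC hoC) <;> rw [hlC]
    · exact (timeForm_pos_iff hkB hkC).2 hlt
    · exact h'.2.1
  · refine (beam_eq_of_ray_eq hE hB hC hc hc' ?_).1
    unfold Beam.ray
    rw [hdir, hor, eq_of_coord_eq hd ?_ heq]
    rw [crossCoord_crossPoint hkB, crossCoord_crossPoint hkC]
  · refine absurd ⟨hcB, ?_, ?_⟩ (h'.2.2.1 oB hoB) <;> rw [hlB]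
    · exact (timeForm_pos_iff hkC hkB).2 hgt
    · exact h.2.1

/-- Every ray that may start belongs to a beam. -/
theorem exists_beam {d : ℤ × ℤ} (hs : s ∈ E.segments) (hd : d ∈ E.directions)
    (h : E.Starts s d c) (o : Bool) :
    ∃ C ∈ E.beams, C.seg = s ∧ C.dir = d ∧ C.orient = o ∧ C.Contains c := by
  have hk : cross d s.line.2 ≠ 0 := MirrorSegment.line_transverse.2 h.1.1
  have hb : ∀ e ∈ E.points, cross d e ∈ E.breaks d ∧ cross d e + 1 ∈ E.breaks d := by
    intro e he
    constructor <;> exact List.mem_append_left _ (List.mem_flatMap.2 ⟨e, he, by simp⟩)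
  have ha1 := hb _ (mem_points_of_mem_endpoints (a_mem_endpoints hs))
  have hb1 := hb _ (mem_points_of_mem_endpoints (b_mem_endpoints hs))
  have hmem := (crossesAt_iff hk _ _).1 h.1.2.1
  rw [segment_eq_image'] at hmem
  obtain ⟨t, ⟨h0, h1⟩, ht⟩ := hmem
  -- The position is a convex combination of those of the endpoints, hence lies between two breaks.
  have hc : (c : ℝ) = (1 - t) * (cross d s.a : ℤ) + t * (cross d s.b : ℤ) := by
    rw [← crossCoord_crossPoint (c := c) hk, ← ht]
    simp only [crossCoord, toPlane, cross, Prod.fst_add, Prod.snd_add, Prod.smul_fst, Prod.smul_snd,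
      Prod.fst_sub, Prod.snd_sub, smul_eq_mul]
    push_cast
    ring
  have hcell : ∃ u ∈ E.cells d, u.1 ≤ c ∧ c < u.2 := by
    rcases le_total (cross d s.a) (cross d s.b) with hab | hab
    · have hab' : ((cross d s.a : ℤ) : ℝ) ≤ (cross d s.b : ℤ) := by exact_mod_cast hab
      have l1 : ((cross d s.a : ℤ) : ℝ) ≤ c := by nlinarith
      have l2 : (c : ℝ) ≤ (cross d s.b : ℤ) := by nlinarith
      exact exists_cell ha1.1 hb1.2 (by exact_mod_cast l1)
        (Int.lt_add_one_of_le (by exact_mod_cast l2))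
    · have hab' : ((cross d s.b : ℤ) : ℝ) ≤ (cross d s.a : ℤ) := by exact_mod_cast hab
      have l1 : ((cross d s.b : ℤ) : ℝ) ≤ c := by nlinarith
      have l2 : (c : ℝ) ≤ (cross d s.a : ℤ) := by nlinarith
      exact exists_cell hb1.1 ha1.2 (by exact_mod_cast l1)
        (Int.lt_add_one_of_le (by exact_mod_cast l2))
  obtain ⟨u, hu, hcu⟩ := hcell
  exact ⟨⟨s, d, o, u.1, u.2⟩, mem_beams.2 (.inr ⟨hs, hd, hu,
    (starts_congr hu hcu ⟨le_rfl, (mem_cells.1 hu).2.2.1⟩ hs).1 h⟩), rfl, rfl, rfl, hcu⟩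

theorem isReflectedRay (hE : E.Valid) (hB : B ∈ E.beams) (h0 : B ≠ E.startBeam)
    (hc : B.Contains c) : E.IsReflectedRay (B.ray c) := by
  obtain ⟨hs, h⟩ := starts_of_contains hB h0 hc
  have hk := MirrorSegment.line_transverse.2 (beam_transverse hE hB)
  have hne : ∀ e ∈ E.endpoints, toPlane e ≠ crossPoint B.dir B.seg.line c := fun e he heq =>
    h.1.2.2.1 e he ((crossesAt_self_iff hk e).2 heq.symm)
  exact ⟨beam_dir hB, B.seg, hs, mem_openSegment_of_ne_left_right (hne _ (a_mem_endpoints hs))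
    (hne _ (b_mem_endpoints hs)) ((crossesAt_iff hk _ _).1 h.1.2.1), h.2.1⟩

/-- Only reflective segments are hit, so the artificial carrier of the initial beam is never a
target. -/
theorem hits_mem_segments (hB : B ∈ E.beams) {d : ℤ × ℤ} {s : MirrorSegment}
    (h : E.Hits s d c B.seg) : B.seg ∈ E.segments := by
  rcases mem_beams.1 hB with rfl | h'
  · have := h.2.2.2.1
    simp [MirrorSegment.ReflectsFrom, startBeam] at this
  · exact h'.1

theorem reflectedAt_unique {r : Ray} {s s' : MirrorSegment} (hs : s ∈ E.segments)
    (hs' : s' ∈ E.segments) (h : E.ReflectedAt r s) (h' : E.ReflectedAt r s') : s = s' := by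
  obtain ⟨t, ⟨h0, h1, h2⟩, h3, h4⟩ := h
  obtain ⟨t', ⟨h0', h1', h2'⟩, h3', h4'⟩ := h'
  have : t = t' := by
    rcases lt_trichotomy t t' with hlt | heq | hgt
    · exact absurd h1 (h2' t h0 hlt)
    · exact heq
    · exact absurd h1' (h2 t' h0' hgt)
  subst this
  by_contra hne
  exact h3 (.inr (.inl ⟨s, hs, s', hs', hne, h4, h4'⟩))

end Beams

end Environment

/-! ### Numbering -/

/-- With a general starting state the left fold becomes a recursion from the front: the offsets in
the tail are shifted by the length of the head. -/
theorem foldl_place (l : List Beam) (n : ℤ) (acc : List (ℤ × Beam)) :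
    l.foldl (fun s B => (s.1 + B.len, (s.1, B) :: s.2)) (n, acc) =
      (n + (place l).1, (place l).2.map (fun x => (n + x.1, x.2)) ++ acc) := by
  induction l generalizing n acc with
  | nil => simp [place]
  | cons B l ih =>
    have e : place (B :: l) = ((B.len + (place l).1),
        (place l).2.map (fun x => (B.len + x.1, x.2)) ++ [(0, B)]) := by
      unfold place
      rw [List.foldl_cons, ih]
      simp [place]
    rw [List.foldl_cons, ih, e]
    simp [add_assoc]

theorem place_cons_fst (B : Beam) (l : List Beam) :
    (place (B :: l)).1 = B.len + (place l).1 := by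
  rw [place, List.foldl_cons, foldl_place]
  simp

theorem mem_place_cons (B : Beam) (l : List Beam) (x : ℤ × Beam) :
    x ∈ (place (B :: l)).2 ↔ x = (0, B) ∨ (x.1 - B.len, x.2) ∈ (place l).2 := by
  rw [place, List.foldl_cons, foldl_place]
  simp only [zero_add, List.mem_append, List.mem_map, List.mem_singleton]
  rw [or_comm]
  refine or_congr Iff.rfl ⟨?_, fun h => ⟨_, h, Prod.ext (by simp) rfl⟩⟩
  rintro ⟨y, hy, rfl⟩
  simpa using hy

theorem mem_place {l : List Beam} (hl : ∀ B ∈ l, 0 < B.len) {x : ℤ × Beam}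
    (hx : x ∈ (place l).2) : x.2 ∈ l ∧ 0 ≤ x.1 ∧ x.1 + x.2.len ≤ (place l).1 := by
  have hpos : ∀ l : List Beam, (∀ B ∈ l, 0 < B.len) → 0 ≤ (place l).1 := by
    intro l hl
    induction l with
    | nil => simp [place]
    | cons B l ih =>
      rw [place_cons_fst]
      have := ih fun C hC => hl C (List.mem_cons_of_mem _ hC)
      have := hl B List.mem_cons_self
      omega
  induction l generalizing x with
  | nil => simp [place] at hx
  | cons B l ih =>
    have h1 := hl B List.mem_cons_self
    have hl' := fun C hC => hl C (List.mem_cons_of_mem B hC)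
    have h2 := hpos l hl'
    rw [place_cons_fst]
    rcases (mem_place_cons _ _ _).1 hx with rfl | h
    · exact ⟨List.mem_cons_self, le_rfl, by dsimp only; omega⟩
    · obtain ⟨a, b, c⟩ := ih hl' h
      dsimp only at *
      exact ⟨List.mem_cons_of_mem _ a, by omega, by omega⟩

theorem exists_place_of_mem {l : List Beam} {B : Beam} (h : B ∈ l) :
    ∃ u, (u, B) ∈ (place l).2 := by
  induction l with
  | nil => simp at h
  | cons C l ih =>
    rcases List.mem_cons.1 h with rfl | h
    · exact ⟨0, (mem_place_cons _ _ _).2 (.inl rfl)⟩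
    · obtain ⟨u, hu⟩ := ih h
      exact ⟨u + C.len, (mem_place_cons _ _ _).2 (.inr (by simpa using hu))⟩

theorem place_eq_of_beam_eq {l : List Beam} (hn : l.Nodup) (hl : ∀ B ∈ l, 0 < B.len)
    {x y : ℤ × Beam} (hx : x ∈ (place l).2) (hy : y ∈ (place l).2) (h : x.2 = y.2) : x = y := by
  induction l generalizing x y with
  | nil => simp [place] at hx
  | cons B l ih =>
    obtain ⟨hB, hn⟩ := List.nodup_cons.1 hn
    have hl' := fun C hC => hl C (List.mem_cons_of_mem B hC)
    rcases (mem_place_cons _ _ _).1 hx with rfl | hx <;>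
      rcases (mem_place_cons _ _ _).1 hy with rfl | hy
    · rfl
    · have := (mem_place hl' hy).1
      rw [← h] at this
      exact absurd this hB
    · have := (mem_place hl' hx).1
      simp only at h
      rw [h] at this
      exact absurd this hB
    · have := ih hn hl' hx hy h
      simp only [Prod.mk.injEq, sub_left_inj] at this
      exact Prod.ext this.1 this.2

theorem place_eq_of_overlap {l : List Beam} (hl : ∀ B ∈ l, 0 < B.len) {x y : ℤ × Beam}
    (hx : x ∈ (place l).2) (hy : y ∈ (place l).2) {v : ℤ} (h1 : x.1 ≤ v) (h2 : v < x.1 + x.2.len)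
    (h3 : y.1 ≤ v) (h4 : v < y.1 + y.2.len) : x = y := by
  induction l generalizing x y v with
  | nil => simp [place] at hx
  | cons B l ih =>
    have hl' := fun C hC => hl C (List.mem_cons_of_mem B hC)
    rcases (mem_place_cons _ _ _).1 hx with rfl | hx <;>
      rcases (mem_place_cons _ _ _).1 hy with rfl | hy
    · rfl
    · have := (mem_place hl' hy).2.1
      dsimp only at *
      omega
    · have := (mem_place hl' hx).2.1
      dsimp only at *
      omega
    · have := ih hl' hx hy (v := v - B.len) (by dsimp only; omega) (by dsimp only; omega)
        (by dsimp only; omega) (by dsimp only; omega)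
      simp only [Prod.mk.injEq, sub_left_inj] at this
      exact Prod.ext this.1 this.2

theorem exists_place {l : List Beam} {v : ℤ} (h0 : 0 ≤ v) (h1 : v < (place l).1) :
    ∃ x ∈ (place l).2, x.1 ≤ v ∧ v < x.1 + x.2.len := by
  induction l generalizing v with
  | nil => simp [place] at h1; omega
  | cons B l ih =>
    rw [place_cons_fst] at h1
    by_cases h : v < B.len
    · exact ⟨(0, B), (mem_place_cons _ _ _).2 (.inl rfl), h0, by simpa using h⟩
    · obtain ⟨x, hx, h2, h3⟩ := ih (v := v - B.len) (by omega) (by omega)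
      exact ⟨(x.1 + B.len, x.2), (mem_place_cons _ _ _).2 (.inr (by simpa using hx)),
        by dsimp only; omega, by dsimp only; omega⟩

/-- Consecutive positions yield evenly spaced origins, so a beam is a single block. -/
theorem crossNum_affine (d : ℤ × ℤ) (k : (ℤ × ℤ) × (ℤ × ℤ)) (c i j : ℤ) :
    (crossNum d k (c + i * j)).1 = (crossNum d k c).1 +
      j * ((crossNum d k (c + i)).1 - (crossNum d k c).1) ∧
    (crossNum d k (c + i * j)).2 = (crossNum d k c).2 +
      j * ((crossNum d k (c + i)).2 - (crossNum d k c).2) := by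
  unfold crossNum
  constructor <;> ring

theorem Beam.rayAt_toBlock {B : Beam} (hB : cross B.seg.vec B.dir ≠ 0) (i : ℕ) :
    B.toBlock.rayAt i = B.ray (B.first + B.sgn * i) := by
  have hk := MirrorSegment.line_transverse.2 hB
  have hZ := crossDen_pos hk
  have e : ((crossDen B.dir B.seg.line).toNat : ℝ) = (crossDen B.dir B.seg.line : ℤ) := by
    exact_mod_cast Int.toNat_of_nonneg hZ.le
  obtain ⟨h1, h2⟩ := crossNum_affine B.dir B.seg.line B.first B.sgn i
  simp only [Block.rayAt, Beam.ray, Beam.toBlock, e, crossPoint, h1, h2, toPlane, Ray.mk.injEq,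
    and_true]
  refine Prod.ext ?_ ?_ <;> simp only [Prod.smul_mk, smul_eq_mul, Prod.mk_add_mk] <;> push_cast <;>
    ring

theorem rayOf_eq_some {l : List Beam} (hl : ∀ B ∈ l, 0 < B.len ∧ cross B.seg.vec B.dir ≠ 0)
    (v : ℕ) (r : Ray) : rayOf (l.map Beam.toBlock) v = some r ↔
      ∃ x ∈ (place l).2, x.1 ≤ v ∧ v < x.1 + x.2.len ∧
        r = x.2.ray (x.2.first + x.2.sgn * (v - x.1)) := by
  induction l generalizing v with
  | nil => simp [place, rayOf]
  | cons B l ih =>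
    have hB := hl B List.mem_cons_self
    have hl' := fun C hC => hl C (List.mem_cons_of_mem B hC)
    have hlen : ((B.toBlock.len : ℕ) : ℤ) = B.len := Int.toNat_of_nonneg hB.1.le
    rw [List.map_cons, rayOf]
    split_ifs with h
    · rw [Beam.rayAt_toBlock hB.2]
      have h' : (v : ℤ) < B.len := by omega
      constructor
      · rintro h2
        refine ⟨(0, B), (mem_place_cons _ _ _).2 (.inl rfl), by simp, by simpa using h', ?_⟩
        simpa using h2.symm
      · rintro ⟨x, hx, h1, h2, rfl⟩
        rcases (mem_place_cons _ _ _).1 hx with rfl | hx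
        · simp
        · have := (mem_place (fun C hC => (hl' C hC).1) hx).2.1
          dsimp only at *
          omega
    · have e : ((v - B.toBlock.len : ℕ) : ℤ) = v - B.len := by omega
      rw [ih hl', e]
      constructor
      · rintro ⟨x, hx, h1, h2, rfl⟩
        refine ⟨(x.1 + B.len, x.2), (mem_place_cons _ _ _).2 (.inr (by simpa using hx)),
          by dsimp only; omega, by dsimp only; omega, ?_⟩
        dsimp only
        congr 3
        ring
      · rintro ⟨x, hx, h1, h2, rfl⟩
        rcases (mem_place_cons _ _ _).1 hx with rfl | hx
        · dsimp only at *
          omega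
        · refine ⟨_, hx, by dsimp only; omega, by dsimp only; omega, ?_⟩
          dsimp only
          congr 3
          ring

/-! ### The interval exchange and its correctness -/

namespace Environment

variable {E : Environment}

/-- Rays of the beam `B` are reflected at the segment of the beam `C` in its direction. -/
def Linked (E : Environment) (B C : Beam) : Prop :=
  (C.orient = !B.orient) ∧ C.dir = mirror C.seg.vec B.dir ∧ E.Hits B.seg B.dir B.lo C.seg

theorem mem_pieces {p : Piece} : p ∈ E.pieces ↔ ∃ x ∈ (place E.beams).2, ∃ y ∈ (place E.beams).2,
    E.Linked x.2 y.2 ∧ (overlap x.2 y.2).1 < (overlap x.2 y.2).2 ∧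
    p = ⟨(x.1 + (overlap x.2 y.2).1).toNat, ((overlap x.2 y.2).2 - (overlap x.2 y.2).1).toNat,
      (y.1 + ((overlap x.2 y.2).1 + shift x.2 y.2)).toNat⟩ := by
  unfold pieces
  rw [mem_dedup]
  simp only [List.mem_flatMap]
  refine exists_congr fun x => and_congr_right fun _ => exists_congr fun y =>
    and_congr_right fun _ => ?_
  unfold piece
  split_ifs with h
  · rw [List.mem_singleton]
    exact ⟨fun hp => ⟨⟨h.1, h.2.1, h.2.2.1⟩, h.2.2.2, hp⟩, fun hp => hp.2.2⟩
  · refine ⟨fun hp => by simp at hp, fun hp => absurd ⟨hp.1.1, hp.1.2.1, hp.1.2.2, hp.2.1⟩ h⟩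

theorem mem_place_beams {x : ℤ × Beam} (hx : x ∈ (place E.beams).2) :
    x.2 ∈ E.beams ∧ 0 ≤ x.1 ∧ x.1 + x.2.len ≤ (place E.beams).1 :=
  mem_place (fun _ hB => beam_len_pos hB) hx

/-- The numbers `v` and `w` of rays of `x.2` and `y.2` have indices that differ by the shift. -/
def Shifted (x y : ℤ × Beam) (v w : ℕ) : Prop :=
  (0 ≤ v - x.1 ∧ v - x.1 < x.2.len) ∧ (0 ≤ w - y.1 ∧ w - y.1 < y.2.len) ∧
    w - y.1 = v - x.1 + shift x.2 y.2

/-- The truncations to natural numbers lose nothing: offsets are nonnegative, and the overlap starts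
at `0` or later in both beams. -/
theorem shifted_iff {x y : ℤ × Beam} (hx : 0 ≤ x.1) (hy : 0 ≤ y.1) (v w : ℕ) :
    Shifted x y v w ↔ (overlap x.2 y.2).1 < (overlap x.2 y.2).2 ∧
      v ∈ Set.Ico (x.1 + (overlap x.2 y.2).1).toNat ((x.1 + (overlap x.2 y.2).1).toNat +
        ((overlap x.2 y.2).2 - (overlap x.2 y.2).1).toNat) ∧
      w = (y.1 + ((overlap x.2 y.2).1 + shift x.2 y.2)).toNat +
        (v - (x.1 + (overlap x.2 y.2).1).toNat) := by
  unfold Shifted overlap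
  rw [Set.mem_Ico]
  dsimp only
  split_ifs <;> omega

/-- Linked beams at indices that differ by the shift. -/
theorem Linked.hits (hE : E.Valid) {x y : ℤ × Beam} (hx : x.2 ∈ E.beams) (hy : y.2 ∈ E.beams)
    (h : E.Linked x.2 y.2) {v w : ℕ} (hs : Shifted x y v w) :
    y.2.seg ∈ E.segments ∧ x.2.Contains (x.2.first + x.2.sgn * (v - x.1)) ∧
      y.2.Contains (y.2.first + y.2.sgn * (w - y.1)) ∧
      y.2.first + y.2.sgn * (w - y.1) =
        y.2.seg.mirrorPos x.2.dir (x.2.first + x.2.sgn * (v - x.1)) ∧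
      E.Hits x.2.seg x.2.dir (x.2.first + x.2.sgn * (v - x.1)) y.2.seg := by
  obtain ⟨ho, hd, hh⟩ := h
  have hseg := hits_mem_segments hy hh
  have hc := (x.2.contains_iff _).2 hs.1
  refine ⟨hseg, hc, (y.2.contains_iff _).2 hs.2.1, ?_, (hits_congr_of_contains hE hx hc hseg).1 hh⟩
  have hsgn : y.2.sgn = -x.2.sgn := by
    unfold Beam.sgn
    rw [ho]
    cases x.2.orient <;> simp
  have h1 := x.2.sgn_mul_sgn
  rw [hs.2.2, hsgn]
  unfold shift MirrorSegment.mirrorPos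
  rw [← hd]
  linear_combination (-(x.2.first + y.2.first -
    (cross y.2.dir y.2.seg.a + cross x.2.dir y.2.seg.a))) * h1

theorem hits_iff_ray (hE : E.Valid) {B : Beam} (hB : B ∈ E.beams) (c : ℤ) {s : MirrorSegment}
    (hs : s ∈ E.segments) : E.Hits B.seg B.dir c s ↔ E.ReflectedAt (B.ray c) s :=
  hits_iff hE (ne_zero_of_mem_directions hE (beam_dir hB)) c B.orient (beam_transverse hE hB) hs

/-- The image of a ray determines the beams and so the piece. -/
theorem target_unique (hE : E.Valid) {x y y' : ℤ × Beam} (hx : x ∈ (place E.beams).2)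
    (hy : y ∈ (place E.beams).2) (hy' : y' ∈ (place E.beams).2) (h : E.Linked x.2 y.2)
    (h' : E.Linked x.2 y'.2) {v w w' : ℕ} (hs : Shifted x y v w) (hs' : Shifted x y' v w') :
    y = y' := by
  have hx2 := (mem_place_beams hx).1
  have hy2 := (mem_place_beams hy).1
  have hy2' := (mem_place_beams hy').1
  obtain ⟨a1, a2, a3, a4, a5⟩ := h.hits hE hx2 hy2 hs
  obtain ⟨b1, b2, b3, b4, b5⟩ := h'.hits hE hx2 hy2' hs'
  have hseg := reflectedAt_unique a1 b1 ((hits_iff_ray hE hx2 _ a1).1 a5)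
    ((hits_iff_ray hE hx2 _ b1).1 b5)
  refine place_eq_of_beam_eq nodup_beams (fun _ hB => beam_len_pos hB) hy hy'
    (beam_eq_of_ray_eq hE hy2 hy2' a3 b3 ?_).1
  unfold Beam.ray
  rw [a4, b4, h.1, h'.1, h.2.1, h'.2.1, hseg]

/-- Mirroring is an involution, so the image determines the line and direction of the incoming ray;
`beam_eq_of_hits` then settles the origin. -/
theorem source_unique (hE : E.Valid) {x x' y : ℤ × Beam} (hx : x ∈ (place E.beams).2)
    (hx' : x' ∈ (place E.beams).2) (hy : y ∈ (place E.beams).2) (h : E.Linked x.2 y.2)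
    (h' : E.Linked x'.2 y.2) {v v' w : ℕ} (hs : Shifted x y v w) (hs' : Shifted x' y v' w) :
    x = x' := by
  have hx2 := (mem_place_beams hx).1
  have hx2' := (mem_place_beams hx').1
  have hy2 := (mem_place_beams hy).1
  obtain ⟨a1, a2, a3, a4, a5⟩ := h.hits hE hx2 hy2 hs
  obtain ⟨b1, b2, b3, b4, b5⟩ := h'.hits hE hx2' hy2 hs'
  have hdir : x.2.dir = x'.2.dir := by
    rw [← mirror_mirror y.2.seg.vec x.2.dir, ← h.2.1, h'.2.1, mirror_mirror]
  have hc : x.2.first + x.2.sgn * (v - x.1) = x'.2.first + x'.2.sgn * (v' - x'.1) := by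
    rw [a4] at b4
    unfold MirrorSegment.mirrorPos at b4
    rw [hdir] at b4
    linarith
  have hor : x.2.orient = x'.2.orient := by
    have := h.1.symm.trans h'.1
    simpa using this
  rw [← hc] at b2 b5
  exact place_eq_of_beam_eq nodup_beams (fun _ hB => beam_len_pos hB) hx hx'
    (beam_eq_of_hits hE hx2 hx2' a2 b2 hdir hor a5 b5)

theorem place_beams_unique {x y : ℤ × Beam} (hx : x ∈ (place E.beams).2)
    (hy : y ∈ (place E.beams).2) {v : ℕ} (h : 0 ≤ v - x.1 ∧ v - x.1 < x.2.len)
    (h' : 0 ≤ v - y.1 ∧ v - y.1 < y.2.len) : x = y :=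
  place_eq_of_overlap (fun _ hB => beam_len_pos hB) hx hy (v := v) (by omega) (by omega) (by omega)
    (by omega)

/-- The interval exchange transformation of an environment. -/
def exchange (E : Environment) (hE : E.Valid) : PartialIET where
  M := (place E.beams).1.toNat
  pieces := E.pieces
  src_le := by
    intro p hp
    obtain ⟨x, hx, y, hy, -, hlt, rfl⟩ := mem_pieces.1 hp
    have h1 := mem_place_beams hx
    unfold overlap at *
    dsimp only at *
    split_ifs at * <;> omega
  dst_le := by
    intro p hp
    obtain ⟨x, hx, y, hy, -, hlt, rfl⟩ := mem_pieces.1 hp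
    have h1 := mem_place_beams hy
    unfold overlap at *
    dsimp only at *
    split_ifs at * <;> omega
  src_disjoint := by
    -- The list has no repetitions, so it is enough that two pieces with a common source value arise
    -- from the same pair of beams.
    refine List.Nodup.pairwise_of_forall_ne (nodup_dedup _) fun p hp q hq hne => ?_
    obtain ⟨x, hx, y, hy, hl, hlt, rfl⟩ := mem_pieces.1 hp
    obtain ⟨x', hx', y', hy', hl', hlt', rfl⟩ := mem_pieces.1 hq
    refine Set.disjoint_left.2 fun v hv hv' => hne ?_
    have s1 := (shifted_iff (mem_place_beams hx).2.1 (mem_place_beams hy).2.1 v _).2 ⟨hlt, hv, rfl⟩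
    have s2 := (shifted_iff (mem_place_beams hx').2.1 (mem_place_beams hy').2.1 v _).2
      ⟨hlt', hv', rfl⟩
    obtain rfl := place_beams_unique hx hx' s1.1 s2.1
    obtain rfl := target_unique hE hx hy hy' hl hl' s1 s2
    rfl
  dst_disjoint := by
    refine List.Nodup.pairwise_of_forall_ne (nodup_dedup _) fun p hp q hq hne => ?_
    obtain ⟨x, hx, y, hy, hl, hlt, rfl⟩ := mem_pieces.1 hp
    obtain ⟨x', hx', y', hy', hl', hlt', rfl⟩ := mem_pieces.1 hq
    refine Set.disjoint_left.2 fun w hw hw' => hne ?_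
    have key : ∀ {a l b : ℕ}, w ∈ Set.Ico b (b + l) →
        ∃ v, v ∈ Set.Ico a (a + l) ∧ w = b + (v - a) := by
      intro a l b h
      rw [Set.mem_Ico] at h
      exact ⟨a + (w - b), Set.mem_Ico.2 (by omega), by omega⟩
    obtain ⟨v, hv, e⟩ := key hw
    obtain ⟨v', hv', e'⟩ := key hw'
    have s1 := (shifted_iff (mem_place_beams hx).2.1 (mem_place_beams hy).2.1 v w).2 ⟨hlt, hv, e⟩
    have s2 := (shifted_iff (mem_place_beams hx').2.1 (mem_place_beams hy').2.1 v' w).2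
      ⟨hlt', hv', e'⟩
    obtain rfl := place_beams_unique hy hy' s1.2.1 s2.2.1
    obtain rfl := source_unique hE hx hx' hy hl hl' s1 s2
    rfl

theorem exchange_maps_iff (hE : E.Valid) (v w : ℕ) : (E.exchange hE).Maps v w ↔
    ∃ x ∈ (place E.beams).2, ∃ y ∈ (place E.beams).2, E.Linked x.2 y.2 ∧ Shifted x y v w := by
  constructor
  · rintro ⟨p, hp, hv, hw⟩
    obtain ⟨x, hx, y, hy, hl, hlt, rfl⟩ := mem_pieces.1 hp
    exact ⟨x, hx, y, hy, hl,
      (shifted_iff (mem_place_beams hx).2.1 (mem_place_beams hy).2.1 v w).2 ⟨hlt, hv, hw⟩⟩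
  · rintro ⟨x, hx, y, hy, hl, hs⟩
    obtain ⟨hlt, hv, hw⟩ :=
      (shifted_iff (mem_place_beams hx).2.1 (mem_place_beams hy).2.1 v w).1 hs
    exact ⟨_, mem_pieces.2 ⟨x, hx, y, hy, hl, hlt, rfl⟩, hv, hw⟩

/-- The output of the algorithm. -/
def output (E : Environment) (hE : E.Valid) : Output where
  f := E.exchange hE
  blocks := E.beams.map Beam.toBlock
  start := 0

theorem output_describes_iff (hE : E.Valid) (v : ℕ) (r : Ray) : (E.output hE).Describes v r ↔
    ∃ x ∈ (place E.beams).2, (0 ≤ v - x.1 ∧ v - x.1 < x.2.len) ∧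
      r = x.2.ray (x.2.first + x.2.sgn * (v - x.1)) := by
  refine (rayOf_eq_some (fun B hB => ⟨beam_len_pos hB, beam_transverse hE hB⟩) v r).trans
    (exists_congr fun x => and_congr_right fun _ => ?_)
  rw [← and_assoc]
  refine and_congr_left fun _ => ?_
  omega

theorem output_correct (hE : E.Valid) : (E.output hE).Correct E where
  den_pos := by
    intro B hB
    obtain ⟨C, hC, rfl⟩ := List.mem_map.1 hB
    have := crossDen_pos (MirrorSegment.line_transverse.2 (beam_transverse hE hC))
    simp only [Beam.toBlock]
    omega
  range := by
    intro v
    change v < (place E.beams).1.toNat ↔ _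
    constructor
    · intro hv
      obtain ⟨x, hx, h1, h2⟩ := exists_place (l := E.beams) (v := v) (by omega) (by omega)
      exact ⟨_, (output_describes_iff hE v _).2 ⟨x, hx, by omega, rfl⟩⟩
    · rintro ⟨r, hr⟩
      obtain ⟨x, hx, h, -⟩ := (output_describes_iff hE v r).1 hr
      have := mem_place_beams hx
      omega
  injective := by
    intro v w r hv hw
    obtain ⟨x, hx, h, rfl⟩ := (output_describes_iff hE v r).1 hv
    obtain ⟨y, hy, h', e⟩ := (output_describes_iff hE w _).1 hw
    obtain ⟨e1, e2⟩ := beam_eq_of_ray_eq hE (mem_place_beams hx).1 (mem_place_beams hy).1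
      ((x.2.contains_iff _).2 h) ((y.2.contains_iff _).2 h') e
    obtain rfl := place_eq_of_beam_eq nodup_beams (fun _ hB => beam_len_pos hB) hx hy e1
    have h1 := x.2.sgn_mul_sgn
    have h2 : x.2.sgn * x.2.sgn * (v - x.1) = x.2.sgn * x.2.sgn * (w - x.1) := by
      linear_combination x.2.sgn * e2
    rw [h1] at h2
    omega
  start := by
    refine (output_describes_iff hE _ _).2 ⟨(0, E.startBeam), ?_, ?_, ?_⟩
    · exact (mem_place_cons _ _ _).2 (.inl rfl)
    · simp [output, Beam.len, startBeam]
    · rw [← startBeam_ray hE]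
      congr 1
      simp [output, Beam.first, Beam.sgn, startBeam]
  values := by
    intro v r hr
    obtain ⟨x, hx, h, rfl⟩ := (output_describes_iff hE v r).1 hr
    have hc := (x.2.contains_iff _).2 h
    by_cases h0 : x.2 = E.startBeam
    · left
      rw [← startBeam_ray hE, h0]
      rw [h0] at hc
      exact congrArg _ (startBeam_contains hc)
    · exact .inr (isReflectedRay hE (mem_place_beams hx).1 h0 hc)
  mem_domain := by
    rintro v ⟨w, hvw⟩
    obtain ⟨x, hx, y, hy, hl, hs⟩ := (exchange_maps_iff hE v w).1 hvw
    have hx2 := (mem_place_beams hx).1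
    have hy2 := (mem_place_beams hy).1
    obtain ⟨a1, a2, a3, a4, a5⟩ := hl.hits hE hx2 hy2 hs
    refine ⟨w, _, _, hvw, (output_describes_iff hE v _).2 ⟨x, hx, hs.1, rfl⟩,
      (output_describes_iff hE w _).2 ⟨y, hy, hs.2.1, rfl⟩, ?_⟩
    have := ((hits_iff_ray hE hx2 _ a1).1 a5).reflectsTo hE (crossCoord_ray hE hx2 _) a1
    convert this using 1
    unfold Beam.ray
    rw [a4, hl.1, hl.2.1]
  not_mem_domain := by
    intro v hv hdom
    obtain ⟨x, hx, h1, h2⟩ := exists_place (l := E.beams) (v := v) (by omega)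
      (by change v < (place E.beams).1.toNat at hv; omega)
    have hx2 := (mem_place_beams hx).1
    have hi : 0 ≤ v - x.1 ∧ v - x.1 < x.2.len := by omega
    refine ⟨_, (output_describes_iff hE v _).2 ⟨x, hx, hi, rfl⟩, ?_⟩
    have hc := (x.2.contains_iff _).2 hi
    rcases escapes_or_absorbed_or_reflectedAt
      (r := x.2.ray (x.2.first + x.2.sgn * (v - x.1)))
      (ne_zero_of_mem_directions hE (beam_dir hx2)) (crossCoord_ray hE hx2 _)
      with h | h | ⟨s, hs, h⟩
    · exact .inl h
    · exact .inr h
    -- A reflected ray would have a numbered image: the image may start, so it lies in some beam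
    -- `C`, and the piece for this pair of beams contains `v`.
    · exfalso
      have hh := (hits_iff_ray hE hx2 _ hs).2 h
      obtain ⟨C, hC, c1, c2, c3, c4⟩ := exists_beam hs (mirror_mem_directions s.vec (beam_dir hx2))
        (hh.starts hE hs) (!x.2.orient)
      obtain ⟨u, hu⟩ := exists_place_of_mem hC
      have hlink : E.Linked x.2 C := by
        refine ⟨c3, by rw [c2, c1], ?_⟩
        rw [c1]
        exact (hits_congr_of_contains hE hx2 hc hs).2 hh
      have hu0 := (mem_place_beams hu).2.1
      dsimp only at hu0
      obtain ⟨j, hj⟩ : ∃ j, j = v - x.1 + shift x.2 C := ⟨_, rfl⟩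
      have hsgn : C.sgn = -x.2.sgn := by
        unfold Beam.sgn
        rw [c3]
        cases x.2.orient <;> simp
      have hpos : C.first + C.sgn * j =
          s.mirrorPos x.2.dir (x.2.first + x.2.sgn * (v - x.1)) := by
        have h1 := x.2.sgn_mul_sgn
        rw [hj, hsgn]
        unfold shift MirrorSegment.mirrorPos
        rw [c1, c2]
        linear_combination (-(x.2.first + C.first -
          (cross (mirror s.vec x.2.dir) s.a + cross x.2.dir s.a))) * h1
      rw [← hpos, C.contains_iff] at c4
      refine hdom ⟨(u + j).toNat, (exchange_maps_iff hE v _).2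
        ⟨x, hx, (u, C), hu, hlink, hi, ?_, ?_⟩⟩ <;> dsimp only <;> omega

end Environment

end MirrorMaze

theorem mainTheorem3 :
    ∃ (p : MirrorMaze.Prog) (T : Polynomial ℕ),
      ∀ E : MirrorMaze.Environment, E.Valid →
        ∃ (O : MirrorMaze.Output) (t : ℕ),
          MirrorMaze.Runs p E.encode O.encode t ∧ t ≤ T.eval E.encode.size ∧ O.Correct E := by
  obtain ⟨p, T, h⟩ := MirrorMaze.PT.outputData (E := fun E : MirrorMaze.Environment => E)
    MirrorMaze.PT.id
  refine ⟨p, T, fun E hE => ?_⟩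
  obtain ⟨t, ht, hr⟩ := h E
  -- The computed data involve no validity proof, and their encoding is by definition that of the
  -- output.
  exact ⟨E.output hE, t, hr, ht, MirrorMaze.Environment.output_correct hE⟩
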